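/- For complex $a,b,c,d,e$ write $(x)_k=x(x+1)\cdots(x+k-1)$. Let ${}_3F_2(a,b,c;d,e\,|\,1)$ denote the analytic function of its five parameters obtained by analytic continuation of $$\sum_{k\ge 0}\frac{(a)_k(b)_k(c)_k}{(d)_k(e)_k\,k!},$$ which converges when the excess $s=d+e-a-b-c$ satisfies $\operatorname{Re}s>0$ and $d,e\notin\{0,-1,-2,\dots\}$; the continuation exists and is holomorphic on the set where none of $d,\,e,\,s$ is a non-positive integer. For $m,n\in\mathbb Z$ define the generalized Dixon, Watson and Whipple elements $$X(a,b,c,m,n)={}_3F_2(a,b,c;\,1+m+a-b,\,1+m+n+a-c\,|\,1),$$ $$W(a,b,c,m,n)={}_3F_2(a,b,c;\,\tfrac12(a+b+1+m),\,2c+n\,|\,1),$$ $$P(a,b,c,m,n)={}_3F_2(a,b,1-b+m+n;\,c,\,1+2a+m-c\,|\,1).$$ Then, for all $m,n\in\mathbb Z$ and all complex $a,b,c$ such that, for the ${}_3F_2$ on each side of the identity in question, neither a denominator parameter nor the excess is a non-positive integer: 1. $$P(a,b,c,m,n)=X(2a-b-c+m+1,\,1+a-c+m,\,1-b+m+n,\,m,n)\,\frac{\Gamma(a-n)\Gamma(c)}{\Gamma(b+c-1-m-n)\Gamma(a-b+m+1)}.$$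 2. $$P(a,b,c,m,n)=W(c-b,\,2a-c+m+1-b,\,a-n,\,m,n)\,\frac{\Gamma(a-n)\Gamma(c)\Gamma(1+m+2a-c)}{\Gamma(b)\Gamma(2a-n)\Gamma(a-b+m+1)}.$$ 3. $$W(a,b,c,m,n)=X\bigl(2c+n-a,\,\tfrac12(b-a+m+1),\,\tfrac12(1+m-a-b)+c+n,\,m,n\bigr)\,\frac{\Gamma(c+n+\frac12(1+m-a-b))\,\Gamma(2c+n)\,\Gamma(\frac12(a+b+1+m))}{\Gamma(a)\,\Gamma(c+n+\frac12(1+m+b-a))\,\Gamma(2c+n+\frac12(1+m-a-b))}.$$ 4. $$X(a,b,c,m,n)=W(1+m+a-2b,\,a,\,1+m+a-b-c,\,m,n)\,\frac{\Gamma(a-2b-2c+2+2m+n)\,\Gamma(1+a-c+m+n)}{\Gamma(1-c+m+n)\,\Gamma(2a-2b-2c+2+2m+n)}.$$ 5. $${}_3F_2\bigl(a,b,c;\,\tfrac12(c+b+n+1+m),\,2a-n\,|\,1\bigr)=W(c,\,2a-b-n,\,a-n,\,m,n)\,\frac{\Gamma(a+\frac12(-c-b-n+1+m))\,\Gamma(\frac12(c+b+n+1+m))}{\Gamma(\frac12(-c+b+n+1+m))\,\Gamma(a+\frac12(c-b-n+1+m))}.$$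 6. $${}_3F_2(a,\,1-a+m,\,b;\,c,\,2b-c+n+1+m\,|\,1)=W(a-c+n+2b,\,2b-c-a+n+1+m,\,b,\,m,n)\,\frac{\Gamma(b+n)\Gamma(c)}{\Gamma(c-b)\Gamma(2b+n)}.$$ -/

import Mathlib

/-- `z` is one of `0, -1, -2, …`, i.e. a pole of the gamma function. -/
def IsNonposInt (z : ℂ) : Prop := ∃ k : ℕ, z = -(k : ℂ)

/-- Parameters of a `₃F₂`: the tuple `(a, b, c, d, e)` has the numerator parameters `a, b, c` and
the denominator parameters `d, e`. -/
abbrev HypParams : Type := ℂ × ℂ × ℂ × ℂ × ℂ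

/-- The parametric excess `d + e - a - b - c`. -/
def hypExcess : HypParams → ℂ
  | (a, b, c, d, e) => d + e - a - b - c

/-- The `k`-th term `(a)_k (b)_k (c)_k / ((d)_k (e)_k k!)` of the series `₃F₂(a, b, c; d, e | 1)`. -/
noncomputable def hypTerm : HypParams → ℕ → ℂ
  | (a, b, c, d, e), k =>
    ((ascPochhammer ℂ k).eval a * (ascPochhammer ℂ k).eval b * (ascPochhammer ℂ k).eval c) /
      ((ascPochhammer ℂ k).eval d * (ascPochhammer ℂ k).eval e * (k.factorial : ℂ))

/-- The open connected set of parameters for which neither a denominator parameter nor the excess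
is a non-positive integer: the domain of holomorphy of the continued `₃F₂(a, b, c; d, e | 1)`. -/
def hypDomain : Set HypParams :=
  {p | ¬ IsNonposInt p.2.2.2.1 ∧ ¬ IsNonposInt p.2.2.2.2 ∧ ¬ IsNonposInt (hypExcess p)}

/-- `F` is the analytic continuation, in all five parameters, of the series
`₃F₂(a, b, c; d, e | 1)`: it is holomorphic on `hypDomain`, and it is the sum of the series wherever
the excess has positive real part. By the identity theorem this determines `F` on `hypDomain`. -/
def IsHypContinuation (F : HypParams → ℂ) : Prop :=
  DifferentiableOn ℂ F hypDomain ∧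
    ∀ p ∈ hypDomain, 0 < (hypExcess p).re → HasSum (hypTerm p) (F p)

open Classical in
/-- `₃F₂(a, b, c; d, e | 1)` as an analytic function of its five parameters. -/
noncomputable def hyp3F2 (p : HypParams) : ℂ :=
  if h : ∃ F : HypParams → ℂ, IsHypContinuation F then h.choose p else ∑' k, hypTerm p k

/-- Parameters of the generalized Dixon element. -/
def dixonParams (a b c : ℂ) (m n : ℤ) : HypParams :=
  (a, b, c, 1 + m + a - b, 1 + m + n + a - c)

/-- Parameters of the generalized Watson element. -/
noncomputable def watsonParams (a b c : ℂ) (m n : ℤ) : HypParams :=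
  (a, b, c, (a + b + 1 + m) / 2, 2 * c + n)

/-- Parameters of the generalized Whipple element. -/
def whippleParams (a b c : ℂ) (m n : ℤ) : HypParams :=
  (a, b, 1 - b + m + n, c, 1 + 2 * a + m - c)

/-- The generalized Dixon element `X_{m,n} = X(a, b, c, m, n)`. -/
noncomputable def dixonX (a b c : ℂ) (m n : ℤ) : ℂ := hyp3F2 (dixonParams a b c m n)

/-- The generalized Watson element `W_{m,n} = W(a, b, c, m, n)`. -/
noncomputable def watsonW (a b c : ℂ) (m n : ℤ) : ℂ := hyp3F2 (watsonParams a b c m n)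

/-- The generalized Whipple element `P_{m,n} = P(a, b, c, m, n)`. -/
noncomputable def whippleP (a b c : ℂ) (m n : ℤ) : ℂ := hyp3F2 (whippleParams a b c m n)

/-! Divide `₃F₂(a, b, c; d, e | 1)` by `Γ(d) Γ(e) Γ(s)`. The quotient `regHyp` is entire in the five
parameters, and for it Thomae's transformation `(a, b, c; d, e) ↦ (a, d - b, d - c; d, d + e - b -
c)` is an exact invariance with no gamma factors. In each of the six identities the two parameter
tuples are related by Thomae's transformation and permutations (`regHyp_thomae`,
`regHyp_thomae_full`, `regHyp_thomae_last`), so the prefactor is the quotient of the two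
regularizing products, with common factors cancelled.

Entirety: terms are bounded by a multiple of `k^(-1-σ)` locally uniformly where `Re s > 0`, and a
contiguous relation, free of division once `1/Γ(s)` is included, pushes the half-plane left
indefinitely (`regHypAux`).

Thomae's transformation is proved for suitable positive real parameters by expanding two Pochhammer
factors with the Pfaff–Saalschütz convolution, exchanging a double sum of nonnegative terms, and
evaluating the inner sum by Gauss's theorem (`tsum_regTerm_thomae`). An identity theorem starting
from an open set of real parameters extends it to all of `ℂ⁵`.

Finally, `hyp3F2` is chosen abstractly, so uniqueness of the continuation on `hypDomain`
(`IsHypContinuation.eqOn`) is needed to identify it with `Γ(d) Γ(e) Γ(s)` times `regHyp`. -/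

open Filter Topology Complex

/-! ### Locally normally convergent series of holomorphic functions -/

/-- Cauchy's estimate on the complex line through `x` in direction `v`. Halving the radius keeps the
closed disc inside the open ball. -/
theorem norm_fderiv_le_of_forall_mem_ball {E : Type*} [NormedAddCommGroup E] [NormedSpace ℂ E]
    {f : E → ℂ} {x : E} {r M : ℝ} (hr : 0 < r) (hM : 0 ≤ M)
    (hf : DifferentiableOn ℂ f (Metric.ball x r)) (hb : ∀ y ∈ Metric.ball x r, ‖f y‖ ≤ M) :
    ‖fderiv ℂ f x‖ ≤ M / (r / 2) := by
  refine ContinuousLinearMap.opNorm_le_bound _ (by positivity) fun v => ?_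
  rcases eq_or_ne v 0 with rfl | hv
  · simp
  have hv' : 0 < ‖v‖ := norm_pos_iff.2 hv
  have hmem : ∀ t ∈ Metric.closedBall (0 : ℂ) (r / 2 / ‖v‖), x + t • v ∈ Metric.ball x r := by
    intro t ht
    rw [mem_closedBall_zero_iff, le_div_iff₀ hv'] at ht
    rw [Metric.mem_ball, dist_eq_norm, add_sub_cancel_left, norm_smul]
    linarith
  have hR : 0 < r / 2 / ‖v‖ := by positivity
  have hl : ∀ t : ℂ, HasDerivAt (fun t : ℂ => x + t • v) v t := fun t => by
    simpa using ((hasDerivAt_id t).smul_const v).const_add x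
  have hd : DifferentiableOn ℂ (fun t : ℂ => f (x + t • v))
      (Metric.closedBall (0 : ℂ) (r / 2 / ‖v‖)) :=
    hf.comp (fun t _ => (hl t).differentiableAt.differentiableWithinAt) hmem
  have h1 := Complex.norm_deriv_le_of_forall_mem_sphere_norm_le hR
    (hd.mono Metric.closure_ball_subset_closedBall).diffContOnCl
    (fun t ht => hb _ (hmem t (Metric.sphere_subset_closedBall ht)))
  have hfx : HasFDerivAt f (fderiv ℂ f x) (x + (0 : ℂ) • v) := by
    rw [zero_smul, add_zero]
    exact (hf.differentiableAt (Metric.ball_mem_nhds x hr)).hasFDerivAt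
  have h2 := (hfx.comp_hasDerivAt (0 : ℂ) (hl 0)).deriv
  have h3 : deriv (fun t : ℂ => f (x + t • v)) 0 = fderiv ℂ f x v := h2
  rw [h3] at h1
  calc _ ≤ _ := h1
    _ = _ := by field_simp

theorem differentiableAt_tsum_of_eventually_norm_le {E : Type*} [NormedAddCommGroup E]
    [NormedSpace ℂ E] {f : ℕ → E → ℂ} {x : E} {M : ℕ → ℝ} (hM : Summable M)
    (hf : ∀ n, Differentiable ℂ (f n)) (hb : ∀ᶠ y in 𝓝 x, ∀ n, ‖f n y‖ ≤ M n) :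
    DifferentiableAt ℂ (fun y => ∑' n, f n y) x := by
  obtain ⟨r, hr, hr'⟩ := Metric.eventually_nhds_iff_ball.1 hb
  have hM0 : ∀ n, 0 ≤ M n := fun n =>
    (norm_nonneg _).trans (hr' x (Metric.mem_ball_self hr) n)
  have hx : x ∈ Metric.ball x (r / 2) := Metric.mem_ball_self (by positivity)
  -- A ball of radius `r / 2` about a point of `ball x (r / 2)` stays in `ball x r`, so Cauchy's
  -- estimate bounds all derivatives there by a summable sequence.
  refine (hasFDerivAt_tsum_of_isPreconnected (u := fun n => M n / (r / 2 / 2))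
    (f' := fun n => fderiv ℂ (f n)) (hM.div_const _)
    Metric.isOpen_ball (convex_ball x (r / 2)).isPreconnected
    (fun n y _ => (hf n y).hasFDerivAt) (fun n y hy => ?_) hx ?_ hx).differentiableAt
  · refine norm_fderiv_le_of_forall_mem_ball (by positivity) (hM0 n) (hf n).differentiableOn
      fun z hz => hr' z ?_ n
    rw [Metric.mem_ball] at *
    linarith [dist_triangle z y x]
  · exact Summable.of_norm_bounded hM fun n => hr' x (Metric.mem_ball_self hr) n

/-! ### Regularized terms -/

/-- The `k`-th term of the series `₃F₂(a, b, c; d, e | 1)` divided by `Γ(d) Γ(e)`. -/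
noncomputable def regTerm (p : HypParams) (k : ℕ) : ℂ :=
  (ascPochhammer ℂ k).eval p.1 * (ascPochhammer ℂ k).eval p.2.1 *
    (ascPochhammer ℂ k).eval p.2.2.1 *
    ((Gamma (p.2.2.2.1 + k))⁻¹ * (Gamma (p.2.2.2.2 + k))⁻¹ * ((k.factorial : ℂ))⁻¹)

theorem hypExcess_eq (p : HypParams) :
    hypExcess p = p.2.2.2.1 + p.2.2.2.2 - p.1 - p.2.1 - p.2.2.1 := rfl

theorem differentiable_hypExcess : Differentiable ℂ hypExcess := by
  have : hypExcess = fun p : HypParams => p.2.2.2.1 + p.2.2.2.2 - p.1 - p.2.1 - p.2.2.1 := rfl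
  rw [this]
  fun_prop

theorem differentiable_regTerm (k : ℕ) : Differentiable ℂ (fun p => regTerm p k) := by
  unfold regTerm
  have h := Complex.differentiable_one_div_Gamma
  have h1 : Differentiable ℂ (fun p : HypParams => (Gamma (p.2.2.2.1 + k))⁻¹) :=
    h.comp (by fun_prop : Differentiable ℂ fun p : HypParams => p.2.2.2.1 + k)
  have h2 : Differentiable ℂ (fun p : HypParams => (Gamma (p.2.2.2.2 + k))⁻¹) :=
    h.comp (by fun_prop : Differentiable ℂ fun p : HypParams => p.2.2.2.2 + k)
  have h3 := (ascPochhammer ℂ k).differentiable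
  have h4 : Differentiable ℂ (fun p : HypParams => (ascPochhammer ℂ k).eval p.1) :=
    h3.comp (by fun_prop : Differentiable ℂ fun p : HypParams => p.1)
  have h5 : Differentiable ℂ (fun p : HypParams => (ascPochhammer ℂ k).eval p.2.1) :=
    h3.comp (by fun_prop : Differentiable ℂ fun p : HypParams => p.2.1)
  have h6 : Differentiable ℂ (fun p : HypParams => (ascPochhammer ℂ k).eval p.2.2.1) :=
    h3.comp (by fun_prop : Differentiable ℂ fun p : HypParams => p.2.2.1)
  exact ((h4.mul h5).mul h6).mul ((h1.mul h2).mul_const _)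

theorem inv_Gamma_eq (z : ℂ) : (Gamma z)⁻¹ = z * (Gamma (z + 1))⁻¹ :=
  Complex.one_div_Gamma_eq_self_mul_one_div_Gamma_add_one z

theorem regTerm_succ (p : HypParams) (k : ℕ) :
    regTerm p (k + 1) * ((p.2.2.2.1 + k) * (p.2.2.2.2 + k) * (k + 1)) =
      (p.1 + k) * (p.2.1 + k) * (p.2.2.1 + k) * regTerm p k := by
  have hk1 : (k : ℂ) + 1 ≠ 0 := by exact_mod_cast k.succ_ne_zero
  obtain ⟨a, b, c, d, e⟩ := p
  simp only [regTerm]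
  rw [inv_Gamma_eq (d + k), inv_Gamma_eq (e + k)]
  simp only [ascPochhammer_succ_eval, Nat.factorial_succ, Nat.cast_mul, Nat.cast_add, Nat.cast_one,
    ← add_assoc]
  generalize (Gamma (d + k + 1))⁻¹ = x, (Gamma (e + k + 1))⁻¹ = y
  rw [mul_inv]
  generalize (k.factorial : ℂ)⁻¹ = z
  linear_combination (ascPochhammer ℂ k).eval a * (a + k) * ((ascPochhammer ℂ k).eval b * (b + k)) *
    ((ascPochhammer ℂ k).eval c * (c + k)) * (x * y) * z * (d + k) * (e + k) *
    mul_inv_cancel₀ hk1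

/-! ### Locally uniform bounds -/

theorem norm_one_add_le_exp (z : ℂ) : ‖1 + z‖ ≤ Real.exp (z.re + ‖z‖ ^ 2 / 2) := by
  refine le_of_pow_le_pow_left₀ two_ne_zero (Real.exp_pos _).le ?_
  have h := Real.add_one_le_exp (2 * (z.re + ‖z‖ ^ 2 / 2))
  have h2 : ‖1 + z‖ ^ 2 = 1 + 2 * z.re + ‖z‖ ^ 2 := by
    rw [Complex.sq_norm, Complex.sq_norm, Complex.normSq_apply, Complex.normSq_apply]
    simp
    ring
  rw [h2, ← Real.exp_nat_mul]
  push_cast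
  linarith

/-- Write `1 / (1 + z) = 1 + w` with `w = -z + z² / (1 + z)` and apply the upper bound to `w`: the
errors `2‖z‖²` from `Re w` and `‖w‖² / 2 ≤ 2‖z‖²` add up to `4‖z‖²`. -/
theorem inv_norm_one_add_le_exp {z : ℂ} (hz : ‖z‖ ≤ 1 / 2) :
    ‖1 + z‖⁻¹ ≤ Real.exp (-z.re + 4 * ‖z‖ ^ 2) := by
  have h1 : 1 / 2 ≤ ‖1 + z‖ := by
    have := norm_sub_norm_le (1 : ℂ) (-z)
    rw [sub_neg_eq_add, norm_neg, norm_one] at this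
    linarith
  have h0 : 1 + z ≠ 0 := norm_pos_iff.1 (by linarith)
  have hinv : ‖1 + z‖⁻¹ ≤ 2 := by
    rw [inv_le_comm₀ (by linarith) (by norm_num)]
    linarith
  have e1 : (1 + z)⁻¹ = 1 + (-z * (1 + z)⁻¹) := by field_simp; ring
  have e2 : -z * (1 + z)⁻¹ = -z + z ^ 2 * (1 + z)⁻¹ := by field_simp; ring
  rw [← norm_inv, e1]
  refine (norm_one_add_le_exp _).trans (Real.exp_le_exp.2 ?_)
  have h3 : ‖-z * (1 + z)⁻¹‖ ≤ 2 * ‖z‖ := by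
    rw [norm_mul, norm_neg, norm_inv]
    nlinarith [norm_nonneg z]
  have h4 : (-z * (1 + z)⁻¹).re ≤ -z.re + 2 * ‖z‖ ^ 2 := by
    rw [e2, add_re, neg_re]
    have : (z ^ 2 * (1 + z)⁻¹).re ≤ 2 * ‖z‖ ^ 2 := by
      refine (Complex.re_le_norm _).trans ?_
      rw [norm_mul, norm_pow, norm_inv]
      nlinarith [sq_nonneg ‖z‖]
    linarith
  nlinarith [norm_nonneg (-z * (1 + z)⁻¹)]

theorem norm_add_natCast_le {a : ℂ} {R : ℝ} {k : ℕ} (ha : ‖a‖ ≤ R) (hk : 0 < k) :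
    ‖a + k‖ ≤ k * Real.exp (a.re / k + R ^ 2 / 2 / k ^ 2) := by
  have hk' : (0 : ℝ) < k := by exact_mod_cast hk
  have hkc : (k : ℂ) ≠ 0 := by exact_mod_cast hk.ne'
  have e : a + k = k * (1 + a / k) := by field_simp; ring
  rw [e, norm_mul, Complex.norm_natCast]
  refine mul_le_mul_of_nonneg_left ((norm_one_add_le_exp _).trans (Real.exp_le_exp.2 ?_)) hk'.le
  rw [Complex.div_natCast_re, norm_div, Complex.norm_natCast, div_pow, div_right_comm]
  gcongr

theorem le_norm_add_natCast {a : ℂ} {R : ℝ} {k : ℕ} (ha : ‖a‖ ≤ R) (hk : 0 < k)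
    (hR : 2 * R ≤ k) :
    k ≤ ‖a + k‖ * Real.exp (-a.re / k + 4 * R ^ 2 / k ^ 2) := by
  have hk' : (0 : ℝ) < k := by exact_mod_cast hk
  have hkc : (k : ℂ) ≠ 0 := by exact_mod_cast hk.ne'
  have e : a + k = k * (1 + a / k) := by field_simp; ring
  have hz : ‖a / k‖ ≤ 1 / 2 := by
    rw [norm_div, Complex.norm_natCast, div_le_iff₀ hk']
    linarith
  have h := inv_norm_one_add_le_exp hz
  have h1 : (0 : ℝ) < ‖1 + a / k‖ := by
    have := norm_sub_norm_le (1 : ℂ) (-(a / k))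
    rw [sub_neg_eq_add, norm_neg, norm_one] at this
    linarith
  rw [inv_le_iff_one_le_mul₀' h1] at h
  have h2 : Real.exp (-(a / k).re + 4 * ‖a / k‖ ^ 2) ≤
      Real.exp (-a.re / k + 4 * R ^ 2 / k ^ 2) := by
    refine Real.exp_le_exp.2 ?_
    rw [Complex.div_natCast_re, norm_div, Complex.norm_natCast, div_pow, ← mul_div_assoc, neg_div]
    gcongr
  rw [e, norm_mul, Complex.norm_natCast, mul_assoc]
  refine le_mul_of_one_le_right hk'.le (h.trans ?_)
  gcongr

/-- The first-order exponents of the six linear factors in the term ratio sum to `-(1 + Re s) / k`.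
The second-order errors are `3 · 1/2` from numerators and `3 · 4` from denominators, in units of `R²
/ k²`, rounded up to `14`. -/
theorem norm_regTerm_succ_le {p : HypParams} {R : ℝ} {k : ℕ} (hp : ‖p‖ ≤ R) (hR : 1 ≤ R)
    (hk : 2 * R ≤ k) :
    ‖regTerm p (k + 1)‖ ≤
      ‖regTerm p k‖ * Real.exp (-(1 + (hypExcess p).re) / k + 14 * R ^ 2 / k ^ 2) := by
  have hk' : (0 : ℝ) < k := by linarith
  have hk0 : 0 < k := by exact_mod_cast hk'
  obtain ⟨a, b, c, d, e⟩ := p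
  simp only [Prod.norm_def, max_le_iff] at hp
  obtain ⟨ha, hb, hc, hd, he⟩ := hp
  have h1 : ‖(1 : ℂ)‖ ≤ R := by simpa using hR
  have h := congrArg norm (regTerm_succ (a, b, c, d, e) k)
  simp only [norm_mul] at h
  have hd' := le_norm_add_natCast hd hk0 hk
  have he' := le_norm_add_natCast he hk0 hk
  have h1' := le_norm_add_natCast h1 hk0 hk
  rw [add_comm (1 : ℂ)] at h1'
  have ha' := norm_add_natCast_le ha hk0
  have hb' := norm_add_natCast_le hb hk0
  have hc' := norm_add_natCast_le hc hk0
  set u := ‖regTerm (a, b, c, d, e) k‖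
  set u' := ‖regTerm (a, b, c, d, e) (k + 1)‖
  have hu : 0 ≤ u := norm_nonneg _
  have hu' : 0 ≤ u' := norm_nonneg _
  have hk3 : (0 : ℝ) < k * k * k := by positivity
  refine le_of_mul_le_mul_right ?_ hk3
  set A := Real.exp (a.re / k + R ^ 2 / 2 / k ^ 2)
  set B := Real.exp (b.re / k + R ^ 2 / 2 / k ^ 2)
  set C := Real.exp (c.re / k + R ^ 2 / 2 / k ^ 2)
  set D := Real.exp (-d.re / k + 4 * R ^ 2 / k ^ 2)
  set E := Real.exp (-e.re / k + 4 * R ^ 2 / k ^ 2)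
  set O := Real.exp (-(1 : ℂ).re / k + 4 * R ^ 2 / k ^ 2)
  calc u' * (k * k * k) ≤ u' * ((‖d + k‖ * D) * (‖e + k‖ * E) * (‖(k : ℂ) + 1‖ * O)) := by
        gcongr
    _ = (u' * (‖d + k‖ * ‖e + k‖ * ‖(k : ℂ) + 1‖)) * (D * E * O) := by ring
    _ = (‖a + k‖ * ‖b + k‖ * ‖c + k‖ * u) * (D * E * O) := by rw [h]
    _ ≤ ((k * A) * (k * B) * (k * C) * u) * (D * E * O) := by gcongr
    _ = u * (A * B * C * (D * E * O)) * (k * k * k) := by ring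
    _ ≤ _ := by
        gcongr
        simp only [A, B, C, D, E, O, ← Real.exp_add]
        refine Real.exp_le_exp.2 ?_
        simp only [hypExcess_eq, sub_re, add_re, one_re]
        have : 0 ≤ R ^ 2 / k ^ 2 := by positivity
        have e1 : R ^ 2 / 2 / k ^ 2 = (R ^ 2 / k ^ 2) / 2 := by ring
        have e2 : 4 * R ^ 2 / k ^ 2 = 4 * (R ^ 2 / k ^ 2) := by ring
        have e3 : 14 * R ^ 2 / k ^ 2 = 14 * (R ^ 2 / k ^ 2) := by ring
        rw [e1, e2, e3]
        ring_nf
        ring_nf at this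
        linarith

/-- Of the decay exponent, at least `(1 + 2σ) / k`, the weight uses `(1 + σ) / k`; the remaining `σ
/ k` absorbs the quadratic error once `k ≥ 14 R² / σ`. -/
theorem norm_regTerm_succ_mul_rpow_le {p : HypParams} {R σ : ℝ} {k : ℕ} (hp : ‖p‖ ≤ R)
    (hR : 1 ≤ R) (hσ : 0 < σ) (hs : 2 * σ ≤ (hypExcess p).re) (hk : 2 * R ≤ k)
    (hk2 : 14 * R ^ 2 / σ ≤ k) :
    ‖regTerm p (k + 1)‖ * ((k : ℝ) + 2) ^ (1 + σ) ≤ ‖regTerm p k‖ * ((k : ℝ) + 1) ^ (1 + σ) := by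
  have hk' : (0 : ℝ) < k := by linarith
  have h := norm_regTerm_succ_le hp hR hk
  have h1 : ((k : ℝ) + 2) ^ (1 + σ) ≤ ((k : ℝ) + 1) ^ (1 + σ) * Real.exp ((1 + σ) / k) := by
    have : (k : ℝ) + 2 ≤ (k + 1) * Real.exp (1 / k) := by
      have := Real.add_one_le_exp (1 / (k : ℝ))
      have h3 : (k : ℝ) + 2 ≤ (k + 1) * (1 / k + 1) := by
        field_simp
        nlinarith
      exact h3.trans (by gcongr)
    calc _ ≤ ((k + 1) * Real.exp (1 / k)) ^ (1 + σ) := by gcongr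
      _ = _ := by
        rw [Real.mul_rpow (by positivity) (Real.exp_pos _).le, ← Real.exp_mul]
        congr 2
        ring
  have h2 : -(1 + (hypExcess p).re) / k + 14 * R ^ 2 / k ^ 2 + (1 + σ) / k ≤ 0 := by
    have : 14 * R ^ 2 / k ^ 2 ≤ σ / k := by
      rw [div_le_iff₀ hσ] at hk2
      rw [div_le_div_iff₀ (by positivity) hk']
      nlinarith
    have h4 : -(1 + (hypExcess p).re) / k + (1 + σ) / k + σ / k ≤ 0 := by
      rw [← add_div, ← add_div]
      exact div_nonpos_of_nonpos_of_nonneg (by linarith) hk'.le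
    linarith
  calc _ ≤ (‖regTerm p k‖ * Real.exp (-(1 + (hypExcess p).re) / k + 14 * R ^ 2 / k ^ 2)) *
        (((k : ℝ) + 1) ^ (1 + σ) * Real.exp ((1 + σ) / k)) := by gcongr
    _ = ‖regTerm p k‖ * ((k : ℝ) + 1) ^ (1 + σ) *
        Real.exp (-(1 + (hypExcess p).re) / k + 14 * R ^ 2 / k ^ 2 + (1 + σ) / k) := by
        rw [Real.exp_add _ ((1 + σ) / k)]; ring
    _ ≤ _ := mul_le_of_le_one_right (by positivity) (Real.exp_le_one_iff.2 h2)

theorem exists_summable_eventually_norm_regTerm_le {p : HypParams} (hp : 0 < (hypExcess p).re) :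
    ∃ M : ℕ → ℝ, Summable M ∧ ∀ᶠ q in 𝓝 p, ∀ k, ‖regTerm q k‖ ≤ M k := by
  -- A quarter, so that `2σ < Re s` holds strictly at `p` and hence on a neighbourhood.
  set σ := (hypExcess p).re / 4 with hσ
  have hσ0 : 0 < σ := by positivity
  set R := ‖p‖ + 1
  obtain ⟨K, hK⟩ := exists_nat_ge (max (2 * R) (14 * R ^ 2 / σ))
  rw [max_le_iff] at hK
  set A := ∑ j ∈ Finset.range (K + 1), (‖regTerm p j‖ + 1) with hA
  have hA0 : 0 ≤ A := Finset.sum_nonneg fun _ _ => by positivity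
  refine ⟨fun k => A * ((K : ℝ) + 1) ^ (1 + σ) * (1 / ((k : ℝ) + 1) ^ (1 + σ)), ?_, ?_⟩
  · refine Summable.mul_left _ ?_
    have := (Real.summable_one_div_nat_rpow (p := 1 + σ)).2 (by linarith)
    simpa using (summable_nat_add_iff 1).2 this
  have e1 : ∀ᶠ q in 𝓝 p, ∀ j ∈ Finset.range (K + 1), ‖regTerm q j‖ < ‖regTerm p j‖ + 1 := by
    rw [Finset.eventually_all]
    intro j _
    have := ((differentiable_regTerm j).continuous.norm).continuousAt (x := p)
    exact this.eventually_lt_const (lt_add_one _)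
  have e2 : ∀ᶠ q in 𝓝 p, ‖q‖ < R :=
    (continuous_norm.continuousAt (x := p)).eventually_lt_const (lt_add_one _)
  have e3 : ∀ᶠ q in 𝓝 p, 2 * σ < (hypExcess q).re :=
    ((Complex.continuous_re.comp differentiable_hypExcess.continuous).continuousAt
      (x := p)).eventually_const_lt (by simp only [Function.comp]; linarith)
  filter_upwards [e1, e2, e3] with q h1 h2 h3 k
  have hle : ∀ j ≤ K, ‖regTerm q j‖ ≤ A := fun j hj =>
    (h1 j (Finset.mem_range.2 (by omega))).le.trans
      (Finset.single_le_sum (f := fun j => ‖regTerm p j‖ + 1) (fun _ _ => by positivity)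
        (Finset.mem_range.2 (by omega)))
  have key : ‖regTerm q k‖ * ((k : ℝ) + 1) ^ (1 + σ) ≤ A * ((K : ℝ) + 1) ^ (1 + σ) := by
    rcases le_total k K with hkK | hkK
    · have := hle k hkK
      gcongr
    · induction k, hkK using Nat.le_induction with
      | base =>
        have := hle K le_rfl
        gcongr
      | succ k hk ih =>
        have hkr : (K : ℝ) ≤ k := by exact_mod_cast hk
        have := norm_regTerm_succ_mul_rpow_le h2.le
          (by simp [R]) hσ0 h3.le (hK.1.trans hkr) (hK.2.trans hkr)
        push_cast
        rw [add_assoc, one_add_one_eq_two]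
        exact this.trans ih
  rw [mul_one_div, le_div_iff₀ (by positivity)]
  exact key

theorem summable_regTerm {p : HypParams} (hp : 0 < (hypExcess p).re) : Summable (regTerm p) := by
  obtain ⟨M, hM, h⟩ := exists_summable_eventually_norm_regTerm_le hp
  exact Summable.of_norm_bounded hM h.self_of_nhds

theorem differentiableAt_tsum_regTerm {p : HypParams} (hp : 0 < (hypExcess p).re) :
    DifferentiableAt ℂ (fun q => ∑' k, regTerm q k) p := by
  obtain ⟨M, hM, h⟩ := exists_summable_eventually_norm_regTerm_le hp
  exact differentiableAt_tsum_of_eventually_norm_le hM differentiable_regTerm h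

/-! ### The contiguous relation -/

/-- The partial sums are `n * u n`. A nonzero limit would make `‖u n‖` at least a constant times `1
/ n`, against summability. -/
theorem tsum_telescope_eq_zero {u : ℕ → ℂ} (hu : Summable u)
    (h : Summable fun k : ℕ => ((k : ℂ) + 1) * u (k + 1) - k * u k) :
    ∑' k : ℕ, (((k : ℂ) + 1) * u (k + 1) - k * u k) = 0 := by
  set L := ∑' k : ℕ, (((k : ℂ) + 1) * u (k + 1) - k * u k)
  have hsum : ∀ n : ℕ, ∑ k ∈ Finset.range n, (((k : ℂ) + 1) * u (k + 1) - k * u k) = n * u n := by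
    intro n
    have := Finset.sum_range_sub (fun k : ℕ => (k : ℂ) * u k) n
    simpa using this
  have ht : Tendsto (fun n : ℕ => (n : ℂ) * u n) atTop (𝓝 L) := by
    simpa only [hsum] using h.hasSum.tendsto_sum_nat
  by_contra hL
  have hL' : 0 < ‖L‖ := norm_pos_iff.2 hL
  have hev : ∀ᶠ n : ℕ in atTop, ‖L‖ / 2 < ‖(n : ℂ) * u n‖ :=
    ht.norm.eventually_const_lt (by linarith)
  refine Real.not_summable_one_div_natCast (summable_of_isBigO_nat hu.norm ?_)
  refine Asymptotics.IsBigO.of_bound (2 / ‖L‖) ?_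
  filter_upwards [hev, eventually_gt_atTop 0] with n hn hn0
  have hn0' : (0 : ℝ) < n := by exact_mod_cast hn0
  rw [norm_mul, Complex.norm_natCast] at hn
  rw [norm_norm, Real.norm_of_nonneg (by positivity), div_mul_eq_mul_div, div_le_div_iff₀ hn0' hL']
  linarith

/-- Raise the first denominator parameter by one. -/
def shiftOne (p : HypParams) : HypParams :=
  (p.1, p.2.1, p.2.2.1, p.2.2.2.1 + 1, p.2.2.2.2)

/-- Raise both denominator parameters by one. -/
def shiftBoth (p : HypParams) : HypParams :=
  (p.1, p.2.1, p.2.2.1, p.2.2.2.1 + 1, p.2.2.2.2 + 1)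

/-- Coefficient of `shiftOne` in the contiguous relation. -/
def coeffOne (p : HypParams) : ℂ :=
  hypExcess p * (p.2.2.2.1 + p.2.2.2.2) +
    (p.1 * p.2.1 + p.2.1 * p.2.2.1 + p.2.2.1 * p.1 - p.2.2.2.1 * p.2.2.2.2)

/-- Coefficient of `shiftBoth` in the contiguous relation. -/
def coeffBoth (p : HypParams) : ℂ :=
  hypExcess p * (p.2.2.2.1 * p.2.2.2.2) + p.1 * p.2.1 * p.2.2.1 - coeffOne p * p.2.2.2.2

theorem hypExcess_shiftOne (p : HypParams) : hypExcess (shiftOne p) = hypExcess p + 1 := by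
  simp only [hypExcess_eq, shiftOne]; ring

theorem hypExcess_shiftBoth (p : HypParams) : hypExcess (shiftBoth p) = hypExcess p + 2 := by
  simp only [hypExcess_eq, shiftBoth]; ring

theorem regTerm_shiftOne (p : HypParams) (k : ℕ) :
    regTerm p k = (p.2.2.2.1 + k) * regTerm (shiftOne p) k := by
  simp only [regTerm, shiftOne]
  rw [inv_Gamma_eq (p.2.2.2.1 + k), add_right_comm p.2.2.2.1 1]
  ring

theorem regTerm_shiftOne_shiftBoth (p : HypParams) (k : ℕ) :
    regTerm (shiftOne p) k = (p.2.2.2.2 + k) * regTerm (shiftBoth p) k := by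
  simp only [regTerm, shiftOne, shiftBoth]
  rw [inv_Gamma_eq (p.2.2.2.2 + k), add_right_comm p.2.2.2.2 1]
  ring

theorem succ_mul_regTerm_succ (p : HypParams) (k : ℕ) :
    ((k : ℂ) + 1) * regTerm p (k + 1) =
      (p.1 + k) * (p.2.1 + k) * (p.2.2.1 + k) * regTerm (shiftBoth p) k := by
  have hk1 : (k : ℂ) + 1 ≠ 0 := by exact_mod_cast k.succ_ne_zero
  obtain ⟨a, b, c, d, e⟩ := p
  simp only [regTerm, shiftBoth]
  simp only [ascPochhammer_succ_eval, Nat.factorial_succ, Nat.cast_mul, Nat.cast_add, Nat.cast_one]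
  rw [add_assoc d, add_assoc e, add_comm (1 : ℂ) k]
  generalize (Gamma (d + (k + 1)))⁻¹ = x, (Gamma (e + (k + 1)))⁻¹ = y
  rw [mul_inv]
  generalize (k.factorial : ℂ)⁻¹ = z
  linear_combination (ascPochhammer ℂ k).eval a * (a + k) * ((ascPochhammer ℂ k).eval b * (b + k)) *
    ((ascPochhammer ℂ k).eval c * (c + k)) * (x * y) * z * mul_inv_cancel₀ hk1

/-- Expressed through `regTerm (shiftBoth p) k`, the relation is a polynomial identity in `k`:
`(a+k)(b+k)(c+k) - k(d+k)(e+k) + s(d+k)(e+k)` has degree one, so it equals `coeffOne p * (e+k) +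
coeffBoth p`. The first two products telescope. -/
theorem contiguous_tsum_regTerm {p : HypParams} (hp : 0 < (hypExcess p).re) :
    hypExcess p * ∑' k, regTerm p k =
      coeffOne p * ∑' k, regTerm (shiftOne p) k + coeffBoth p * ∑' k, regTerm (shiftBoth p) k := by
  have h0 := summable_regTerm hp
  have h1 : Summable (regTerm (shiftOne p)) := summable_regTerm (by
    rw [hypExcess_shiftOne]; simp only [add_re, one_re]; linarith)
  have h2 : Summable (regTerm (shiftBoth p)) := summable_regTerm (by
    rw [hypExcess_shiftBoth]; simp only [add_re, re_ofNat]; linarith)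
  have key : ∀ k : ℕ, ((k : ℂ) + 1) * regTerm p (k + 1) - k * regTerm p k =
      coeffOne p * regTerm (shiftOne p) k + coeffBoth p * regTerm (shiftBoth p) k -
        hypExcess p * regTerm p k := by
    intro k
    rw [succ_mul_regTerm_succ, regTerm_shiftOne p, regTerm_shiftOne_shiftBoth p, coeffBoth, coeffOne,
      hypExcess_eq]
    ring
  have hs := ((h1.mul_left (coeffOne p)).add (h2.mul_left (coeffBoth p))).sub
    (h0.mul_left (hypExcess p))
  have hz := tsum_telescope_eq_zero h0 (hs.congr fun k => (key k).symm)
  simp only [key] at hz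
  rw [((h1.mul_left _).add (h2.mul_left _)).tsum_sub (h0.mul_left _),
    (h1.mul_left _).tsum_add (h2.mul_left _), tsum_mul_left, tsum_mul_left, tsum_mul_left] at hz
  linear_combination -hz

/-! ### The entire regularization -/

/-- The regularized `₃F₂`, continued by `N` steps to `-N < Re s`. -/
noncomputable def regHypAux : ℕ → HypParams → ℂ
  | 0, p => (Gamma (hypExcess p))⁻¹ * ∑' k, regTerm p k
  | N + 1, p => coeffOne p * regHypAux N (shiftOne p) +
      coeffBoth p * (hypExcess p + 1) * regHypAux N (shiftBoth p)

theorem differentiable_shiftOne : Differentiable ℂ shiftOne := by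
  unfold shiftOne; fun_prop

theorem differentiable_shiftBoth : Differentiable ℂ shiftBoth := by
  unfold shiftBoth; fun_prop

theorem differentiable_coeffOne : Differentiable ℂ coeffOne := by
  have := differentiable_hypExcess
  unfold coeffOne; fun_prop

theorem differentiable_coeffBoth : Differentiable ℂ coeffBoth := by
  have := differentiable_hypExcess
  have := differentiable_coeffOne
  unfold coeffBoth; fun_prop

theorem differentiableAt_regHypAux {N : ℕ} {p : HypParams} (hp : -(N : ℝ) < (hypExcess p).re) :
    DifferentiableAt ℂ (regHypAux N) p := by
  induction N generalizing p with
  | zero =>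
    have h1 : DifferentiableAt ℂ (fun q => (Gamma (hypExcess q))⁻¹) p :=
      (Complex.differentiable_one_div_Gamma.comp differentiable_hypExcess) p
    exact h1.mul (differentiableAt_tsum_regTerm (by simpa using hp))
  | succ N ih =>
    push_cast at hp
    have h1 : DifferentiableAt ℂ (fun q => regHypAux N (shiftOne q)) p := by
      refine DifferentiableAt.comp p (ih ?_) (differentiable_shiftOne p)
      rw [hypExcess_shiftOne]; simp only [add_re, one_re]; linarith
    have h2 : DifferentiableAt ℂ (fun q => regHypAux N (shiftBoth q)) p := by
      refine DifferentiableAt.comp p (ih ?_) (differentiable_shiftBoth p)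
      rw [hypExcess_shiftBoth]; simp only [add_re, re_ofNat]; linarith
    exact ((differentiable_coeffOne p).mul h1).add
      (((differentiable_coeffBoth p).mul ((differentiable_hypExcess p).add_const 1)).mul h2)

/-- Multiply the contiguous relation by `1/Γ(s+1)` and use `1/Γ(s) = s/Γ(s+1)` and `1/Γ(s+1) =
(s+1)/Γ(s+2)`; the latter is the source of the factor `s + 1` in `regHypAux`. -/
theorem regHypAux_succ_eq {N : ℕ} {p : HypParams} (hp : -(N : ℝ) < (hypExcess p).re) :
    regHypAux (N + 1) p = regHypAux N p := by
  induction N generalizing p with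
  | zero =>
    have hp' : 0 < (hypExcess p).re := by simpa using hp
    simp only [regHypAux, hypExcess_shiftOne, hypExcess_shiftBoth]
    have h1 := inv_Gamma_eq (hypExcess p)
    have h2 := inv_Gamma_eq (hypExcess p + 1)
    rw [add_assoc, one_add_one_eq_two] at h2
    linear_combination -(∑' k, regTerm p k) * h1 -
      (Gamma (hypExcess p + 1))⁻¹ * contiguous_tsum_regTerm hp' -
      coeffBoth p * (∑' k, regTerm (shiftBoth p) k) * h2
  | succ N ih =>
    push_cast at hp
    rw [regHypAux, ih, ih, ← regHypAux]
    · rw [hypExcess_shiftBoth]; simp only [add_re, re_ofNat]; linarith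
    · rw [hypExcess_shiftOne]; simp only [add_re, one_re]; linarith

theorem regHypAux_eq_of_le {M N : ℕ} {p : HypParams} (hMN : M ≤ N)
    (hp : -(M : ℝ) < (hypExcess p).re) : regHypAux N p = regHypAux M p := by
  induction N, hMN using Nat.le_induction with
  | base => rfl
  | succ N hN ih =>
    rw [regHypAux_succ_eq, ih]
    have : (M : ℝ) ≤ N := by exact_mod_cast hN
    linarith

/-- `₃F₂(a, b, c; d, e | 1) / (Γ(d) Γ(e) Γ(s))`, an entire function of the five parameters. -/
noncomputable def regHyp (p : HypParams) : ℂ :=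
  regHypAux (⌊-(hypExcess p).re⌋₊ + 1) p

theorem regHyp_eq_regHypAux {N : ℕ} {p : HypParams} (hp : -(N : ℝ) < (hypExcess p).re) :
    regHyp p = regHypAux N p := by
  have h : -((⌊-(hypExcess p).re⌋₊ + 1 : ℕ) : ℝ) < (hypExcess p).re := by
    have := Nat.lt_floor_add_one (-(hypExcess p).re)
    push_cast
    linarith
  rw [regHyp]
  rcases le_total (⌊-(hypExcess p).re⌋₊ + 1) N with hN | hN
  · exact (regHypAux_eq_of_le hN h).symm
  · exact regHypAux_eq_of_le hN hp

theorem regHyp_eq_tsum {p : HypParams} (hp : 0 < (hypExcess p).re) :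
    regHyp p = (Gamma (hypExcess p))⁻¹ * ∑' k, regTerm p k :=
  regHyp_eq_regHypAux (N := 0) (by simpa using hp)

theorem differentiable_regHyp : Differentiable ℂ regHyp := by
  intro p
  -- The number of steps in `regHyp` jumps with the parameters; near `p` a single `N` serves.
  obtain ⟨N, hN⟩ := exists_nat_gt (-(hypExcess p).re)
  refine (differentiableAt_regHypAux (N := N) (by linarith)).congr_of_eventuallyEq ?_
  have : ∀ᶠ q in 𝓝 p, -(N : ℝ) < (hypExcess q).re :=
    ((Complex.continuous_re.comp differentiable_hypExcess.continuous).continuousAt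
      (x := p)).eventually_const_lt (by simp only [Function.comp]; linarith)
  filter_upwards [this] with q hq using regHyp_eq_regHypAux hq

/-! ### The identity theorem from real parameters -/

theorem eq_zero_on_line {E : Type*} [NormedAddCommGroup E] [NormedSpace ℂ E] {f : E → ℂ}
    (hf : Differentiable ℂ f) (x v : E) (h : ∀ᶠ t : ℝ in 𝓝 0, f (x + (t : ℂ) • v) = 0) (t : ℂ) :
    f (x + t • v) = 0 := by
  have hg : Differentiable ℂ fun t : ℂ => f (x + t • v) := hf.comp (by fun_prop)
  have ht : Tendsto (fun t : ℝ => (t : ℂ)) (𝓝[≠] 0) (𝓝[≠] 0) := by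
    refine tendsto_nhdsWithin_iff.2 ⟨?_, ?_⟩
    · exact (Complex.continuous_ofReal.tendsto' 0 0 (by simp)).mono_left nhdsWithin_le_nhds
    · filter_upwards [self_mem_nhdsWithin] with t ht
      simpa using ht
  have := AnalyticOnNhd.eq_of_frequently_eq (z₀ := (0 : ℂ))
    (Complex.analyticOnNhd_univ_iff_differentiable.2 hg)
    (analyticOnNhd_const (v := (0 : ℂ)))
    (ht.frequently (h.filter_mono nhdsWithin_le_nhds).frequently)
  exact congrFun this t

/-- The inclusion of real parameters. -/
def realParams (r : ℝ × ℝ × ℝ × ℝ × ℝ) : HypParams :=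
  (r.1, r.2.1, r.2.2.1, r.2.2.2.1, r.2.2.2.2)

theorem realParams_add_smul (r v : ℝ × ℝ × ℝ × ℝ × ℝ) (t : ℝ) :
    realParams (r + t • v) = realParams r + (t : ℂ) • realParams v := by
  simp [realParams]

/-- Two uses of the one-variable identity theorem: along real lines through `r₀` to reach every real
point, then along `t ↦ Re p + t Im p`, evaluated at `t = I`. -/
theorem eq_zero_of_eventually_realParams {f : HypParams → ℂ} (hf : Differentiable ℂ f)
    (r₀ : ℝ × ℝ × ℝ × ℝ × ℝ) (h : ∀ᶠ r in 𝓝 r₀, f (realParams r) = 0) (p : HypParams) :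
    f p = 0 := by
  have hreal : ∀ r, f (realParams r) = 0 := by
    intro r
    have h1 := eq_zero_on_line hf (realParams r₀) (realParams (r - r₀)) (by
      have hc : Tendsto (fun t : ℝ => r₀ + t • (r - r₀)) (𝓝 0) (𝓝 r₀) := by
        refine Continuous.tendsto' (by fun_prop) _ _ (by simp)
      filter_upwards [hc.eventually h] with t ht
      rwa [realParams_add_smul] at ht) (1 : ℝ)
    rw [← realParams_add_smul] at h1
    simpa using h1
  have h2 := eq_zero_on_line hf
    (realParams (p.1.re, p.2.1.re, p.2.2.1.re, p.2.2.2.1.re, p.2.2.2.2.re))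
    (realParams (p.1.im, p.2.1.im, p.2.2.1.im, p.2.2.2.1.im, p.2.2.2.2.im))
    (Eventually.of_forall fun t => by rw [← realParams_add_smul]; exact hreal _) I
  convert! h2 using 2
  simp [realParams, mul_comm I, Complex.re_add_im]

/-! ### Gauss's summation theorem -/

/-- The `i`-th term of the regularized series `₂F₁(x, y; z | 1) / Γ(z)`. -/
noncomputable def gaussTerm (x y z : ℂ) (i : ℕ) : ℂ :=
  (ascPochhammer ℂ i).eval x * (ascPochhammer ℂ i).eval y *
    ((Gamma (z + i))⁻¹ * ((i.factorial : ℂ))⁻¹)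

theorem regTerm_eq_gaussTerm (a b c d e : ℂ) (k : ℕ) :
    regTerm (a, b, c, d, e) k =
      (ascPochhammer ℂ k).eval a * (Gamma (e + k))⁻¹ * gaussTerm b c d k := by
  simp only [regTerm, gaussTerm]; ring

/-- Since `(1)_k = Γ(1 + k) = k!`, Gauss's series is a special case, and its convergence is
inherited. -/
theorem regTerm_one_eq_gaussTerm (x y z : ℂ) :
    regTerm (1, x, y, z, 1) = gaussTerm x y z := by
  funext k
  have hk : ((k.factorial : ℂ)) ≠ 0 := by exact_mod_cast k.factorial_ne_zero
  rw [regTerm_eq_gaussTerm, ascPochhammer_eval_one, add_comm (1 : ℂ), Complex.Gamma_nat_eq_factorial,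
    mul_inv_cancel₀ hk, one_mul]

theorem summable_gaussTerm {x y z : ℂ} (h : 0 < (z - x - y).re) : Summable (gaussTerm x y z) := by
  rw [← regTerm_one_eq_gaussTerm]
  refine summable_regTerm ?_
  rw [hypExcess_eq]
  simp only [sub_re, add_re, one_re] at *
  linarith

theorem succ_mul_gaussTerm_succ (x y z : ℂ) (k : ℕ) :
    ((k : ℂ) + 1) * gaussTerm x y z (k + 1) = (x + k) * (y + k) * gaussTerm x y (z + 1) k := by
  have hk1 : (k : ℂ) + 1 ≠ 0 := by exact_mod_cast k.succ_ne_zero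
  simp only [gaussTerm, ascPochhammer_succ_eval, Nat.factorial_succ, Nat.cast_mul, Nat.cast_add,
    Nat.cast_one]
  rw [add_assoc z, add_comm (1 : ℂ) k]
  generalize (Gamma (z + (k + 1)))⁻¹ = t
  rw [mul_inv]
  generalize (k.factorial : ℂ)⁻¹ = r
  linear_combination (ascPochhammer ℂ k).eval x * (x + k) * ((ascPochhammer ℂ k).eval y * (y + k)) *
    t * r * mul_inv_cancel₀ hk1

theorem gaussTerm_add_one (x y z : ℂ) (k : ℕ) :
    gaussTerm x y z k = (z + k) * gaussTerm x y (z + 1) k := by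
  simp only [gaussTerm]
  rw [inv_Gamma_eq (z + k), add_right_comm z 1]
  ring

theorem contiguous_tsum_gaussTerm {x y z : ℂ} (h : 0 < (z - x - y).re) :
    (z - x - y) * ∑' k, gaussTerm x y z k =
      (z - x) * (z - y) * ∑' k, gaussTerm x y (z + 1) k := by
  have h0 := summable_gaussTerm h
  have h1 : Summable (gaussTerm x y (z + 1)) := summable_gaussTerm (by
    simp only [sub_re, add_re, one_re] at *; linarith)
  have key : ∀ k : ℕ, ((k : ℂ) + 1) * gaussTerm x y z (k + 1) - k * gaussTerm x y z k =
      (z - x) * (z - y) * gaussTerm x y (z + 1) k - (z - x - y) * gaussTerm x y z k := by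
    intro k
    rw [succ_mul_gaussTerm_succ, gaussTerm_add_one x y z]
    ring
  have hs := (h1.mul_left ((z - x) * (z - y))).sub (h0.mul_left (z - x - y))
  have hz := tsum_telescope_eq_zero h0 (hs.congr fun k => (key k).symm)
  simp only [key] at hz
  rw [(h1.mul_left _).tsum_sub (h0.mul_left _), tsum_mul_left, tsum_mul_left] at hz
  linear_combination -hz

theorem inv_Gamma_eq_ascPochhammer_mul (z : ℂ) (n : ℕ) :
    (Gamma z)⁻¹ = (ascPochhammer ℂ n).eval z * (Gamma (z + n))⁻¹ := by
  induction n with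
  | zero => simp
  | succ n ih =>
    rw [ih, ascPochhammer_succ_eval, inv_Gamma_eq (z + n)]
    push_cast
    ring_nf

/-- Iterating the contiguous relation moves `z` to infinity, where the series reduces to its first
term. -/
theorem inv_Gamma_mul_tsum_gaussTerm_eq {x y z : ℂ} (h : 0 < (z - x - y).re) (n : ℕ) :
    (Gamma (z - x - y))⁻¹ * ∑' k, gaussTerm x y z k =
      (ascPochhammer ℂ n).eval (z - x) * (ascPochhammer ℂ n).eval (z - y) *
        ((Gamma (z - x - y + n))⁻¹ * ∑' k, gaussTerm x y (z + n) k) := by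
  induction n with
  | zero => simp
  | succ n ih =>
    have h' : 0 < (z + n - x - y).re := by
      simp only [sub_re, add_re, natCast_re] at *
      have : (0 : ℝ) ≤ n := n.cast_nonneg
      linarith
    have hc := contiguous_tsum_gaussTerm h'
    rw [ih, ascPochhammer_succ_eval, ascPochhammer_succ_eval, inv_Gamma_eq (z - x - y + n)]
    push_cast
    rw [← add_assoc, ← add_assoc]
    linear_combination (ascPochhammer ℂ n).eval (z - x) * (ascPochhammer ℂ n).eval (z - y) *
      (Gamma (z - x - y + n + 1))⁻¹ * hc

theorem tendsto_inv_ascPochhammer_add (z : ℂ) (i : ℕ) :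
    Tendsto (fun n : ℕ => ((ascPochhammer ℂ i).eval (z + n))⁻¹) atTop (𝓝 (if i = 0 then 1 else 0)) := by
  induction i with
  | zero => simp
  | succ i ih =>
    have h : Tendsto (fun n : ℕ => (z + n + i)⁻¹) atTop (𝓝 0) := by
      refine Tendsto.comp tendsto_inv₀_cobounded ?_
      have : Tendsto (fun n : ℕ => (n : ℂ)) atTop (Bornology.cobounded ℂ) :=
        tendsto_norm_atTop_iff_cobounded.1 (by
          simpa only [Complex.norm_natCast] using tendsto_natCast_atTop_atTop)
      have h2 := tendsto_add_const_cobounded (z + i) |>.comp this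
      refine h2.congr fun n => ?_
      simp only [Function.comp]; ring
    have := ih.mul h
    simp only [mul_zero] at this
    simpa [ascPochhammer_succ_eval, mul_comm] using this

theorem norm_ascPochhammer_le_add {z : ℂ} (hz : 0 ≤ z.re) (i n : ℕ) :
    ‖(ascPochhammer ℂ i).eval z‖ ≤ ‖(ascPochhammer ℂ i).eval (z + n)‖ := by
  induction i with
  | zero => simp
  | succ i ih =>
    rw [ascPochhammer_succ_eval, ascPochhammer_succ_eval, norm_mul, norm_mul]
    refine mul_le_mul ih ?_ (norm_nonneg _) (norm_nonneg _)
    refine le_of_sq_le_sq ?_ (norm_nonneg _)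
    rw [Complex.sq_norm, Complex.sq_norm, Complex.normSq_apply, Complex.normSq_apply]
    simp only [add_re, add_im, natCast_re, natCast_im, add_zero]
    have h1 : (0 : ℝ) ≤ n := n.cast_nonneg
    have h2 : (0 : ℝ) ≤ i := i.cast_nonneg
    nlinarith [mul_nonneg h1 h2, mul_nonneg h1 hz]

theorem ne_neg_natCast_of_re_pos {z : ℂ} (hz : 0 < z.re) (k : ℕ) : z ≠ -k := by
  rintro rfl
  simp only [neg_re, natCast_re] at hz
  have : (0 : ℝ) ≤ k := k.cast_nonneg
  linarith

theorem Gamma_mul_gaussTerm {x y z : ℂ} (hz : 0 < z.re) (i : ℕ) :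
    Gamma z * gaussTerm x y z i = (ascPochhammer ℂ i).eval x * (ascPochhammer ℂ i).eval y *
      ((i.factorial : ℂ))⁻¹ * ((ascPochhammer ℂ i).eval z)⁻¹ := by
  have h := Complex.Gamma_add_nat_div_Gamma_eq (n := i) z (ne_neg_natCast_of_re_pos hz)
  rw [← h, gaussTerm, inv_div]
  ring

theorem tendsto_Gamma_mul_tsum_gaussTerm {x y z : ℂ} (h : 0 < (z - x - y).re) (hz : 0 < z.re) :
    Tendsto (fun n : ℕ => Gamma (z + n) * ∑' k, gaussTerm x y (z + n) k) atTop (𝓝 1) := by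
  have hzn : ∀ n : ℕ, 0 < (z + n).re := fun n => by
    simp only [add_re, natCast_re]; positivity
  simp only [← tsum_mul_left, Gamma_mul_gaussTerm (hzn _)]
  have h1 : (1 : ℂ) = ∑' i : ℕ, (ascPochhammer ℂ i).eval x * (ascPochhammer ℂ i).eval y *
      ((i.factorial : ℂ))⁻¹ * (if i = 0 then 1 else 0) := by
    rw [tsum_eq_single 0 (fun i hi => by simp [hi])]
    simp
  rw [h1]
  -- For `Re z > 0` the denominators `|(z + n)_i|` are at least `|(z)_i|`, so the unshifted series
  -- dominates.
  refine tendsto_tsum_of_dominated_convergence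
    (bound := fun i => ‖Gamma z * gaussTerm x y z i‖) ?_ ?_ ?_
  · exact ((summable_gaussTerm h).mul_left _).norm
  · exact fun i => (tendsto_inv_ascPochhammer_add z i).const_mul _
  · refine Eventually.of_forall fun n i => ?_
    have hne : (ascPochhammer ℂ i).eval z ≠ 0 := by
      rw [← Complex.Gamma_add_nat_div_Gamma_eq z (ne_neg_natCast_of_re_pos hz)]
      exact div_ne_zero (Gamma_ne_zero_of_re_pos (hzn i)) (Gamma_ne_zero_of_re_pos hz)
    rw [Gamma_mul_gaussTerm hz]
    generalize (ascPochhammer ℂ i).eval x * (ascPochhammer ℂ i).eval y *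
      ((i.factorial : ℂ))⁻¹ = A
    rw [norm_mul, norm_mul, norm_inv, norm_inv]
    have := norm_ascPochhammer_le_add hz.le i n
    have h0 : 0 < ‖(ascPochhammer ℂ i).eval z‖ := norm_pos_iff.2 hne
    exact mul_le_mul_of_nonneg_left (inv_anti₀ h0 this) (norm_nonneg _)

theorem GammaSeq_eq_ascPochhammer (w : ℂ) (n : ℕ) :
    GammaSeq w n = (n : ℂ) ^ w * n.factorial / (ascPochhammer ℂ (n + 1)).eval w := by
  have h : ∀ m : ℕ, ∏ j ∈ Finset.range m, (w + j) = (ascPochhammer ℂ m).eval w := by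
    intro m
    induction m with
    | zero => simp
    | succ m ih => rw [Finset.prod_range_succ, ih, ascPochhammer_succ_eval]
  rw [GammaSeq, h]

theorem tsum_gaussTerm {x y z : ℂ} (h : 0 < (z - x - y).re) (hx : 0 < x.re) (hy : 0 < y.re) :
    ∑' k, gaussTerm x y z k = Gamma (z - x - y) * ((Gamma (z - x))⁻¹ * (Gamma (z - y))⁻¹) := by
  have hzx : 0 < (z - x).re := by simp only [sub_re] at *; linarith
  have hzy : 0 < (z - y).re := by simp only [sub_re] at *; linarith
  have hz : 0 < z.re := by simp only [sub_re] at *; linarith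
  have g1 := Gamma_ne_zero_of_re_pos h
  have g2 := Gamma_ne_zero_of_re_pos hz
  have g3 := Gamma_ne_zero_of_re_pos hzx
  have g4 := Gamma_ne_zero_of_re_pos hzy
  have hl := (((GammaSeq_tendsto_Gamma (z - x - y)).mul (GammaSeq_tendsto_Gamma z)).div
    ((GammaSeq_tendsto_Gamma (z - x)).mul (GammaSeq_tendsto_Gamma (z - y)))
    (mul_ne_zero g3 g4)).mul
    ((tendsto_Gamma_mul_tsum_gaussTerm h hz).comp (tendsto_add_atTop_nat 1))
  -- This sequence is constant for `n > 0`: the powers of `n` cancel because `(z-x-y) + z = (z-x) +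
  -- (z-y)`. `GammaSeq w n` contains `(w)_{n+1}`, hence the shift by `n + 1`.
  have hc : ∀ᶠ n : ℕ in atTop, GammaSeq (z - x - y) n * GammaSeq z n /
      (GammaSeq (z - x) n * GammaSeq (z - y) n) *
        (Gamma (z + (n + 1 : ℕ)) * ∑' k, gaussTerm x y (z + (n + 1 : ℕ)) k) =
      Gamma z * ∑' k, gaussTerm x y z k := by
    filter_upwards [eventually_gt_atTop 0] with n hn
    have hn' : (n : ℂ) ≠ 0 := by exact_mod_cast hn.ne'
    have hk : ((n.factorial : ℂ)) ≠ 0 := by exact_mod_cast n.factorial_ne_zero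
    have e1 := inv_Gamma_mul_tsum_gaussTerm_eq h (n + 1)
    have e2 := inv_Gamma_eq_ascPochhammer_mul (z - x - y) (n + 1)
    have e3 := inv_Gamma_eq_ascPochhammer_mul z (n + 1)
    have n1 : ∀ w : ℂ, 0 < w.re → (ascPochhammer ℂ (n + 1)).eval w ≠ 0 := by
      intro w hw h0
      have := inv_Gamma_eq_ascPochhammer_mul w (n + 1)
      rw [h0, zero_mul] at this
      exact inv_ne_zero (Gamma_ne_zero_of_re_pos hw) this
    have p1 := n1 _ h
    have p2 := n1 _ hz
    have p3 := n1 _ hzx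
    have p4 := n1 _ hzy
    have g5 : Gamma (z + (n + 1 : ℕ)) ≠ 0 := Gamma_ne_zero_of_re_pos (by
      simp only [add_re, natCast_re]; positivity)
    have g6 : Gamma (z - x - y + (n + 1 : ℕ)) ≠ 0 := Gamma_ne_zero_of_re_pos (by
      rw [add_re, natCast_re]; positivity)
    have hpow : (n : ℂ) ^ (z - x - y) * (n : ℂ) ^ z = (n : ℂ) ^ (z - x) * (n : ℂ) ^ (z - y) := by
      rw [← cpow_add _ _ hn', ← cpow_add _ _ hn']; ring_nf
    have q1 : (n : ℂ) ^ (z - x) ≠ 0 := by simp [cpow_eq_zero_iff, hn']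
    have q2 : (n : ℂ) ^ (z - y) ≠ 0 := by simp [cpow_eq_zero_iff, hn']
    simp only [GammaSeq_eq_ascPochhammer]
    generalize (∑' k, gaussTerm x y (z + (n + 1 : ℕ)) k) = T at *
    generalize (∑' k, gaussTerm x y z k) = S at *
    generalize Gamma (z + (n + 1 : ℕ)) = G5 at *
    generalize Gamma (z - x - y + (n + 1 : ℕ)) = G6 at *
    generalize (ascPochhammer ℂ (n + 1)).eval (z - x - y) = P1 at *
    generalize (ascPochhammer ℂ (n + 1)).eval z = P2 at *
    generalize (ascPochhammer ℂ (n + 1)).eval (z - x) = P3 at *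
    generalize (ascPochhammer ℂ (n + 1)).eval (z - y) = P4 at *
    generalize (n : ℂ) ^ (z - x) = Q1, (n : ℂ) ^ (z - y) = Q2,
      (n : ℂ) ^ (z - x - y) = Q3, (n : ℂ) ^ z = Q4 at *
    have s1 : Gamma z * S = Gamma z * Gamma (z - x - y) * (P3 * P4 * (G6⁻¹ * T)) := by
      rw [← e1]; field_simp
    have s2 : Gamma z = G5 / P2 := by rw [← inv_inv (Gamma z), e3]; field_simp
    have s3 : Gamma (z - x - y) = G6 / P1 := by rw [← inv_inv (Gamma (z - x - y)), e2]; field_simp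
    rw [s1, s2, s3]
    field_simp
    linear_combination T * hpow
  have := tendsto_nhds_unique (tendsto_const_nhds.congr' (hc.mono fun n hn => hn.symm)) hl
  field_simp
  field_simp at this
  linear_combination this

/-! ### The Pfaff–Saalschütz convolution -/

/-- A telescoping certificate: the recurrence in `k` satisfied by the convolution has summand equal
to a difference in `j`. At `m = k + 1` the right side is minus the missing term `j = k + 1`. -/
theorem saalschutz_partial {p q w : ℂ} {ρ τ : ℕ → ℂ}
    (hρ : ∀ i : ℕ, ((i : ℂ) + 1) * ρ (i + 1) = (w + i) * ρ i)
    (hτ : ∀ j : ℕ, ((j : ℂ) + 1) * (p + q + w + j) * τ (j + 1) = (p + j) * (q + j) * τ j)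
    (k m : ℕ) (hm : m ≤ k + 1) :
    ∑ j ∈ Finset.range m, (((k : ℂ) + 1) * (p + q + w + k) * (τ j * ρ (k + 1 - j)) -
      (p + w + k) * (q + w + k) * (τ j * ρ (k - j))) =
      -(m * (p + q + w + m - 1) * τ m * ρ (k + 1 - m)) := by
  induction m with
  | zero => simp
  | succ m ih =>
    rw [Finset.sum_range_succ, ih (by omega)]
    obtain ⟨i, rfl⟩ := Nat.exists_eq_add_of_le (Nat.le_of_succ_le_succ hm)
    have hi : (i : ℂ) + 1 ≠ 0 := by exact_mod_cast i.succ_ne_zero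
    rw [show m + i + 1 - m = i + 1 by omega, show m + i - m = i by omega,
      show m + i + 1 - (m + 1) = i by omega]
    refine mul_left_cancel₀ hi ?_
    push_cast
    linear_combination τ m * (((m : ℂ) + i + 1) * (p + q + w + (m + i)) -
      m * (p + q + w + m - 1)) * hρ i + (i + 1) * ρ i * hτ m

theorem saalschutz_succ {p q w : ℂ} {ρ τ : ℕ → ℂ}
    (hρ : ∀ i : ℕ, ((i : ℂ) + 1) * ρ (i + 1) = (w + i) * ρ i)
    (hτ : ∀ j : ℕ, ((j : ℂ) + 1) * (p + q + w + j) * τ (j + 1) = (p + j) * (q + j) * τ j)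
    (k : ℕ) :
    ((k : ℂ) + 1) * (p + q + w + k) * ∑ j ∈ Finset.range (k + 2), τ j * ρ (k + 1 - j) =
      (p + w + k) * (q + w + k) * ∑ j ∈ Finset.range (k + 1), τ j * ρ (k - j) := by
  have h := saalschutz_partial hρ hτ k (k + 1) le_rfl
  rw [Finset.sum_sub_distrib, ← Finset.mul_sum, ← Finset.mul_sum] at h
  rw [Finset.sum_range_succ, Nat.sub_self]
  rw [Nat.sub_self] at h
  push_cast at h
  linear_combination h

/-- Coefficientwise form of Euler's transformation `₂F₁(q+w, p+w; p+q+w; t) = (1-t)^(-w) ₂F₁(p, q;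
p+q+w; t)`. Both sides obey the same first-order recurrence in `k`, whose leading factor is nonzero
by `hd`. -/
theorem sum_gaussTerm_mul {p q w : ℂ} (hd : ∀ k : ℕ, p + q + w ≠ -k) (k : ℕ) :
    ∑ j ∈ Finset.range (k + 1), gaussTerm p q (p + q + w) j *
      ((ascPochhammer ℂ (k - j)).eval w * (((k - j).factorial : ℂ))⁻¹) =
      gaussTerm (q + w) (p + w) (p + q + w) k := by
  have hτ : ∀ (x y : ℂ) (j : ℕ), ((j : ℂ) + 1) * (p + q + w + j) * gaussTerm x y (p + q + w) (j + 1) =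
      (x + j) * (y + j) * gaussTerm x y (p + q + w) j := by
    intro x y j
    rw [gaussTerm_add_one x y _ j]
    linear_combination (p + q + w + j) * succ_mul_gaussTerm_succ x y (p + q + w) j
  have hρ : ∀ i : ℕ, ((i : ℂ) + 1) *
      ((ascPochhammer ℂ (i + 1)).eval w * (((i + 1).factorial : ℂ))⁻¹) =
      (w + i) * ((ascPochhammer ℂ i).eval w * ((i.factorial : ℂ))⁻¹) := by
    intro i
    have hi : (i : ℂ) + 1 ≠ 0 := by exact_mod_cast i.succ_ne_zero
    rw [ascPochhammer_succ_eval, Nat.factorial_succ, Nat.cast_mul, Nat.cast_add, Nat.cast_one,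
      mul_inv]
    field_simp
  induction k with
  | zero => simp [gaussTerm]
  | succ k ih =>
    have hk : (k : ℂ) + 1 ≠ 0 := by exact_mod_cast k.succ_ne_zero
    have hdk : p + q + w + k ≠ 0 := fun h0 => hd k (by linear_combination h0)
    refine mul_left_cancel₀ (mul_ne_zero hk hdk) ?_
    rw [hτ]
    have := saalschutz_succ (ρ := fun i => (ascPochhammer ℂ i).eval w * ((i.factorial : ℂ))⁻¹)
      hρ (hτ p q) k
    rw [this, ih]
    ring

section Thomae

open scoped ComplexOrder

/-! ### Thomae's transformation -/

theorem summable_of_antidiagonal_of_nonneg {f : ℕ × ℕ → ℂ} (hf : ∀ x, 0 ≤ f x)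
    (h : Summable fun n => ∑ x ∈ Finset.HasAntidiagonal.antidiagonal n, f x) : Summable f := by
  refine Summable.of_norm ?_
  rw [← Finset.HasAntidiagonal.sigmaAntidiagonalEquivProd.summable_iff,
    summable_sigma_of_nonneg fun _ => by exact norm_nonneg _]
  refine ⟨fun n => (hasSum_fintype _).summable, h.norm.congr fun n => ?_⟩
  have h1 : ∀ x, f x = ((‖f x‖ : ℝ) : ℂ) := fun x => (Complex.norm_of_nonneg' (hf x)).symm
  have h2 : ∑ x ∈ Finset.HasAntidiagonal.antidiagonal n, f x = ((∑ x ∈ Finset.HasAntidiagonal.antidiagonal n, ‖f x‖ : ℝ) : ℂ) := by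
    rw [Complex.ofReal_sum]
    exact Finset.sum_congr rfl fun x _ => h1 x
  rw [h2, Complex.norm_real, Real.norm_of_nonneg (Finset.sum_nonneg fun _ _ => norm_nonneg _),
    tsum_fintype, ← Finset.sum_coe_sort]
  rfl

theorem tsum_eq_tsum_sum_antidiagonal {f : ℕ × ℕ → ℂ} (hf : Summable f) :
    ∑' x, f x = ∑' n, ∑ x ∈ Finset.HasAntidiagonal.antidiagonal n, f x := by
  rw [← Finset.HasAntidiagonal.sigmaAntidiagonalEquivProd.tsum_eq f]
  have hs := (Finset.HasAntidiagonal.sigmaAntidiagonalEquivProd (A := ℕ)).summable_iff.2 hf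
  refine (hs.tsum_sigma' fun n => (hasSum_fintype _).summable).trans ?_
  exact tsum_congr fun n => (tsum_fintype _).trans (Finset.sum_coe_sort _ f)

theorem ascPochhammer_eval_add (x : ℂ) (n m : ℕ) :
    (ascPochhammer ℂ (n + m)).eval x =
      (ascPochhammer ℂ n).eval x * (ascPochhammer ℂ m).eval (x + n) := by
  rw [← ascPochhammer_mul]
  simp

theorem ascPochhammer_eval_ofReal_nonneg {x : ℝ} (hx : 0 ≤ x) (n : ℕ) :
    0 ≤ (ascPochhammer ℂ n).eval (x : ℂ) := by
  induction n with
  | zero => simp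
  | succ n ih =>
    rw [ascPochhammer_succ_eval]
    refine mul_nonneg ih ?_
    have : (0 : ℝ) ≤ x + n := by positivity
    exact_mod_cast this

theorem inv_Gamma_ofReal_add_nonneg {x : ℝ} (hx : 0 < x) (n : ℕ) :
    0 ≤ (Gamma ((x : ℂ) + n))⁻¹ := by
  have h : (x : ℂ) + n = ((x + n : ℝ) : ℂ) := by push_cast; rfl
  rw [h, Complex.Gamma_ofReal, ← Complex.ofReal_inv]
  have : 0 ≤ (Real.Gamma (x + n))⁻¹ := inv_nonneg.2 (Real.Gamma_pos_of_pos (by positivity)).le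
  exact_mod_cast this

theorem inv_factorial_nonneg (n : ℕ) : 0 ≤ ((n.factorial : ℂ))⁻¹ := by
  have h : ((n.factorial : ℂ))⁻¹ = (((n.factorial : ℝ)⁻¹ : ℝ) : ℂ) := by push_cast; rfl
  rw [h]
  have : (0 : ℝ) ≤ (n.factorial : ℝ)⁻¹ := by positivity
  exact_mod_cast this

/-- The parameters `p = d - b`, `q = d - c`, `w = b + c - d` turn Thomae's transformation into
Euler's. Positivity makes every term of the double series nonnegative, so summability of its
diagonal sums allows the rearrangement. -/
theorem tsum_regTerm_thomae {a p q w e : ℝ} (ha : 0 < a) (hp : 0 < p) (hq : 0 < q) (hw : 0 < w)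
    (hs : 0 < e - a - w) :
    ∑' k, regTerm (a, q + w, p + w, p + q + w, e) k =
      Gamma (e - a - w) * (Gamma (e - a))⁻¹ * ∑' k, regTerm (a, p, q, p + q + w, e - w) k := by
  have he : 0 < e := by linarith
  set F : ℕ × ℕ → ℂ := fun x => (ascPochhammer ℂ (x.1 + x.2)).eval (a : ℂ) *
    (Gamma (e + (x.1 + x.2 : ℕ)))⁻¹ * (gaussTerm p q (p + q + w) x.1 *
      ((ascPochhammer ℂ x.2).eval (w : ℂ) * ((x.2.factorial : ℂ))⁻¹)) with hF
  have hF0 : ∀ x, 0 ≤ F x := fun x => by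
    refine mul_nonneg (mul_nonneg (ascPochhammer_eval_ofReal_nonneg ha.le _)
      (inv_Gamma_ofReal_add_nonneg he _)) (mul_nonneg ?_ (mul_nonneg
        (ascPochhammer_eval_ofReal_nonneg hw.le _) (inv_factorial_nonneg _)))
    refine mul_nonneg (mul_nonneg (ascPochhammer_eval_ofReal_nonneg hp.le _)
      (ascPochhammer_eval_ofReal_nonneg hq.le _)) (mul_nonneg ?_ (inv_factorial_nonneg _))
    have := inv_Gamma_ofReal_add_nonneg (x := p + q + w) (by positivity) x.1
    push_cast at this
    exact this
  have hanti : ∀ k, ∑ x ∈ Finset.HasAntidiagonal.antidiagonal k, F x =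
      regTerm (a, q + w, p + w, p + q + w, e) k := by
    intro k
    have hd : ∀ k : ℕ, (p : ℂ) + q + w ≠ -k := ne_neg_natCast_of_re_pos (by
      simp only [add_re, ofReal_re]; positivity)
    rw [regTerm_eq_gaussTerm, ← sum_gaussTerm_mul hd, Finset.mul_sum,
      Finset.Nat.sum_antidiagonal_eq_sum_range_succ_mk]
    refine Finset.sum_congr rfl fun j hj => ?_
    have : j + (k - j) = k := by have := Finset.mem_range.1 hj; omega
    simp only [hF, this]
  have hsum : Summable (regTerm ((a : ℂ), (q : ℂ) + w, (p : ℂ) + w, (p : ℂ) + q + w, (e : ℂ))) := by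
    refine summable_regTerm ?_
    rw [hypExcess_eq]
    simp only [sub_re, add_re, ofReal_re]
    linarith
  have hFs : Summable F :=
    summable_of_antidiagonal_of_nonneg hF0 (hsum.congr fun k => (hanti k).symm)
  have h1 := tsum_eq_tsum_sum_antidiagonal hFs
  simp only [hanti] at h1
  rw [← h1, hFs.tsum_prod, ← tsum_mul_left]
  congr with j
  have h2 : ∀ i, F (j, i) = (ascPochhammer ℂ j).eval (a : ℂ) * gaussTerm p q (p + q + w) j *
      gaussTerm (a + j) w (e + j) i := by
    intro i
    simp only [hF, gaussTerm, ascPochhammer_eval_add]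
    push_cast
    rw [← add_assoc]
    ring
  simp only [h2]
  -- The inner sum is Gauss's with arguments `a + j`, `w`, `e + j`; its excess `e - a - w` does not
  -- depend on `j`, so that gamma factor comes out of the outer sum.
  rw [tsum_mul_left, tsum_gaussTerm]
  · rw [regTerm_eq_gaussTerm]
    ring_nf
  · simp only [sub_re, add_re, ofReal_re, natCast_re]; linarith
  · simp only [add_re, ofReal_re, natCast_re]; positivity
  · simpa using hw

/-- The factor `Γ(e - a - w) / Γ(e - a)` in the real identity is the quotient of the gammas of the
two excesses, which the regularization absorbs. At the base point `(1, 2, 2, 3, 3)` each of the five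
positive quantities equals `1`. -/
theorem regHyp_thomae (a b c d e : ℂ) :
    regHyp (a, b, c, d, e) = regHyp (a, d - b, d - c, d, d + e - b - c) := by
  have hdiff : Differentiable ℂ fun P : HypParams => regHyp P -
      regHyp (P.1, P.2.2.2.1 - P.2.1, P.2.2.2.1 - P.2.2.1, P.2.2.2.1,
        P.2.2.2.1 + P.2.2.2.2 - P.2.1 - P.2.2.1) :=
    differentiable_regHyp.sub (differentiable_regHyp.comp (by fun_prop))
  have h := eq_zero_of_eventually_realParams hdiff (1, 2, 2, 3, 3) ?_ (a, b, c, d, e)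
  · exact sub_eq_zero.1 h
  have h1 : ∀ᶠ r : ℝ × ℝ × ℝ × ℝ × ℝ in 𝓝 (1, 2, 2, 3, 3), 0 < r.1 :=
    (by fun_prop : Continuous fun r : ℝ × ℝ × ℝ × ℝ × ℝ => r.1).continuousAt.eventually_const_lt
      (by norm_num)
  have h2 : ∀ᶠ r : ℝ × ℝ × ℝ × ℝ × ℝ in 𝓝 (1, 2, 2, 3, 3), 0 < r.2.2.2.1 - r.2.1 :=
    (by fun_prop : Continuous fun r : ℝ × ℝ × ℝ × ℝ × ℝ =>
      r.2.2.2.1 - r.2.1).continuousAt.eventually_const_lt (by norm_num)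
  have h3 : ∀ᶠ r : ℝ × ℝ × ℝ × ℝ × ℝ in 𝓝 (1, 2, 2, 3, 3), 0 < r.2.2.2.1 - r.2.2.1 :=
    (by fun_prop : Continuous fun r : ℝ × ℝ × ℝ × ℝ × ℝ =>
      r.2.2.2.1 - r.2.2.1).continuousAt.eventually_const_lt (by norm_num)
  have h4 : ∀ᶠ r : ℝ × ℝ × ℝ × ℝ × ℝ in 𝓝 (1, 2, 2, 3, 3), 0 < r.2.1 + r.2.2.1 - r.2.2.2.1 :=
    (by fun_prop : Continuous fun r : ℝ × ℝ × ℝ × ℝ × ℝ =>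
      r.2.1 + r.2.2.1 - r.2.2.2.1).continuousAt.eventually_const_lt (by norm_num)
  have h5 : ∀ᶠ r : ℝ × ℝ × ℝ × ℝ × ℝ in 𝓝 (1, 2, 2, 3, 3),
      0 < r.2.2.2.2 - r.1 - (r.2.1 + r.2.2.1 - r.2.2.2.1) :=
    (by fun_prop : Continuous fun r : ℝ × ℝ × ℝ × ℝ × ℝ =>
      r.2.2.2.2 - r.1 - (r.2.1 + r.2.2.1 - r.2.2.2.1)).continuousAt.eventually_const_lt
        (by norm_num)
  filter_upwards [h1, h2, h3, h4, h5] with ⟨a, b, c, d, e⟩ h1 h2 h3 h4 h5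
  simp only at h1 h2 h3 h4 h5
  have hT := tsum_regTerm_thomae h1 h2 h3 h4 h5
  simp only [realParams]
  have hs : 0 < (hypExcess ((a : ℂ), (b : ℂ), (c : ℂ), (d : ℂ), (e : ℂ))).re := by
    rw [hypExcess_eq]; simp only [sub_re, add_re, ofReal_re]; linarith
  have hs' : 0 < (hypExcess ((a : ℂ), (d - b : ℂ), (d - c : ℂ), (d : ℂ), (d + e - b - c : ℂ))).re := by
    rw [hypExcess_eq]; simp only [sub_re, add_re, ofReal_re]; linarith
  rw [regHyp_eq_tsum hs, regHyp_eq_tsum hs', sub_eq_zero]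
  push_cast at hT
  have g := Gamma_ne_zero_of_re_pos hs
  rw [hypExcess_eq] at g
  rw [hypExcess_eq, hypExcess_eq]
  simp only at g ⊢
  ring_nf at hT g ⊢
  rw [hT]
  field_simp

end Thomae

/-! ### Symmetries of the regularized function -/

theorem regHyp_eq_of_forall_re_pos {φ : HypParams → HypParams} (hφ : Differentiable ℂ φ)
    (hs : ∀ p, hypExcess (φ p) = hypExcess p) (h : ∀ p k, regTerm (φ p) k = regTerm p k)
    (p : HypParams) : regHyp (φ p) = regHyp p := by
  have hdiff : Differentiable ℂ fun p => regHyp (φ p) - regHyp p :=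
    (differentiable_regHyp.comp hφ).sub differentiable_regHyp
  refine sub_eq_zero.1 (eq_zero_of_eventually_realParams hdiff (0, 0, 0, 1, 1) ?_ p)
  have h5 : ∀ᶠ r : ℝ × ℝ × ℝ × ℝ × ℝ in 𝓝 (0, 0, 0, 1, 1),
      0 < r.2.2.2.1 + r.2.2.2.2 - r.1 - r.2.1 - r.2.2.1 :=
    (by fun_prop : Continuous fun r : ℝ × ℝ × ℝ × ℝ × ℝ =>
      r.2.2.2.1 + r.2.2.2.2 - r.1 - r.2.1 - r.2.2.1).continuousAt.eventually_const_lt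
        (by norm_num)
  filter_upwards [h5] with r hr
  have hp : 0 < (hypExcess (realParams r)).re := by
    rw [hypExcess_eq]; simpa [realParams] using hr
  rw [regHyp_eq_tsum hp, regHyp_eq_tsum (by rwa [hs]), hs]
  simp only [h, sub_self]

theorem regHyp_swap_num (a b c d e : ℂ) : regHyp (b, a, c, d, e) = regHyp (a, b, c, d, e) :=
  regHyp_eq_of_forall_re_pos (φ := fun p => (p.2.1, p.1, p.2.2.1, p.2.2.2.1, p.2.2.2.2))
    (by fun_prop) (fun p => by simp only [hypExcess_eq]; ring)
    (fun p k => by simp only [regTerm]; ring) (a, b, c, d, e)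

theorem regHyp_rotate_num (a b c d e : ℂ) : regHyp (b, c, a, d, e) = regHyp (a, b, c, d, e) :=
  regHyp_eq_of_forall_re_pos (φ := fun p => (p.2.1, p.2.2.1, p.1, p.2.2.2.1, p.2.2.2.2))
    (by fun_prop) (fun p => by simp only [hypExcess_eq]; ring)
    (fun p k => by simp only [regTerm]; ring) (a, b, c, d, e)

theorem regHyp_swap_den (a b c d e : ℂ) : regHyp (a, b, c, e, d) = regHyp (a, b, c, d, e) :=
  regHyp_eq_of_forall_re_pos (φ := fun p => (p.1, p.2.1, p.2.2.1, p.2.2.2.2, p.2.2.2.1))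
    (by fun_prop) (fun p => by simp only [hypExcess_eq]; ring)
    (fun p k => by simp only [regTerm]; ring) (a, b, c, d, e)

/-- Thomae's classical form, two applications of `regHyp_thomae` with a permutation between. It
exchanges the first numerator parameter with the excess. -/
theorem regHyp_thomae_full (a b c d e : ℂ) :
    regHyp (a, b, c, d, e) =
      regHyp (d - a, e - a, d + e - a - b - c, d + e - a - c, d + e - a - b) := by
  rw [← regHyp_swap_num, regHyp_thomae, ← regHyp_swap_den, ← regHyp_swap_num, regHyp_thomae,
    ← regHyp_swap_num, regHyp_rotate_num, regHyp_rotate_num]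
  ring_nf

/-! ### The analytic continuation -/

/-- At its poles `Gamma` takes the value `0`, so its inverse there agrees with the entire function
`1/Γ`. -/
theorem not_isNonposInt_iff (z : ℂ) : ¬ IsNonposInt z ↔ (Gamma z)⁻¹ ≠ 0 := by
  rw [Ne, inv_eq_zero, Complex.Gamma_eq_zero_iff, IsNonposInt]

theorem Gamma_ne_zero_of_not_isNonposInt {z : ℂ} (h : ¬ IsNonposInt z) : Gamma z ≠ 0 :=
  fun h0 => (not_isNonposInt_iff z).1 h (by rw [h0, inv_zero])

theorem differentiableAt_Gamma_of_not_isNonposInt {z : ℂ} (h : ¬ IsNonposInt z) :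
    DifferentiableAt ℂ Gamma z :=
  Complex.differentiableAt_Gamma z fun m hm => h ⟨m, hm⟩

theorem isOpen_hypDomain : IsOpen hypDomain := by
  have hc : Continuous fun z : ℂ => (Gamma z)⁻¹ := Complex.differentiable_one_div_Gamma.continuous
  have h : IsOpen {z : ℂ | ¬ IsNonposInt z} := by
    simp only [not_isNonposInt_iff]
    exact isOpen_ne_fun hc continuous_const
  exact (h.preimage (by fun_prop : Continuous fun p : HypParams => p.2.2.2.1)).inter
    ((h.preimage (by fun_prop : Continuous fun p : HypParams => p.2.2.2.2)).inter
      (h.preimage differentiable_hypExcess.continuous))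

/-- The continuation of the series, obtained from the entire function `regHyp`. -/
noncomputable def hypCont (p : HypParams) : ℂ :=
  Gamma p.2.2.2.1 * Gamma p.2.2.2.2 * Gamma (hypExcess p) * regHyp p

theorem hypTerm_eq {p : HypParams} (hp : p ∈ hypDomain) (k : ℕ) :
    hypTerm p k = Gamma p.2.2.2.1 * Gamma p.2.2.2.2 * regTerm p k := by
  obtain ⟨a, b, c, d, e⟩ := p
  obtain ⟨hd, he, -⟩ := hp
  have h1 := Complex.Gamma_add_nat_div_Gamma_eq (n := k) d fun m hm => hd ⟨m, hm⟩
  have h2 := Complex.Gamma_add_nat_div_Gamma_eq (n := k) e fun m hm => he ⟨m, hm⟩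
  simp only [hypTerm, regTerm]
  rw [← h1, ← h2]
  simp only [div_eq_mul_inv, mul_inv, inv_inv]
  ring

theorem isHypContinuation_hypCont : IsHypContinuation hypCont := by
  refine ⟨fun p hp => ?_, fun p hp hs => ?_⟩
  · obtain ⟨hd, he, hx⟩ := hp
    have h1 : DifferentiableAt ℂ (fun q : HypParams => Gamma q.2.2.2.1) p :=
      (differentiableAt_Gamma_of_not_isNonposInt hd).comp p
        (by fun_prop : DifferentiableAt ℂ (fun q : HypParams => q.2.2.2.1) p)
    have h2 : DifferentiableAt ℂ (fun q : HypParams => Gamma q.2.2.2.2) p :=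
      (differentiableAt_Gamma_of_not_isNonposInt he).comp p
        (by fun_prop : DifferentiableAt ℂ (fun q : HypParams => q.2.2.2.2) p)
    have h3 : DifferentiableAt ℂ (fun q : HypParams => Gamma (hypExcess q)) p :=
      (differentiableAt_Gamma_of_not_isNonposInt hx).comp p (differentiable_hypExcess p)
    exact (((h1.mul h2).mul h3).mul (differentiable_regHyp p)).differentiableWithinAt
  · have h := (summable_regTerm hs).hasSum.mul_left (Gamma p.2.2.2.1 * Gamma p.2.2.2.2)
    have hg := Gamma_ne_zero_of_re_pos hs
    have e1 : hypCont p = Gamma p.2.2.2.1 * Gamma p.2.2.2.2 * ∑' k, regTerm p k := by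
      rw [hypCont, regHyp_eq_tsum hs]
      field_simp
    have e2 : hypTerm p = fun k => Gamma p.2.2.2.1 * Gamma p.2.2.2.2 * regTerm p k :=
      funext (hypTerm_eq hp)
    rw [e1, e2]
    exact h

theorem countable_setOf_isNonposInt_line {x v : ℂ} (hx : ¬ IsNonposInt x) :
    {t : ℂ | IsNonposInt (x + t * v)}.Countable := by
  rcases eq_or_ne v 0 with rfl | hv
  · simp [hx]
  · refine (Set.countable_range fun k : ℕ => (-(k : ℂ) - x) / v).mono ?_
    rintro t ⟨k, hk⟩
    refine ⟨k, ?_⟩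
    simp only
    rw [← hk]
    field_simp
    ring

/-- The complex line from `q`, with excess `2`, to `p` leaves `hypDomain` at only countably many
points, and the plane minus a countable set is connected. Near `q` both functions are the sum of the
series. -/
theorem IsHypContinuation.eqOn {F G : HypParams → ℂ} (hF : IsHypContinuation F)
    (hG : IsHypContinuation G) : Set.EqOn F G hypDomain := by
  intro p hp
  set q : HypParams := (0, 0, 0, 1, 1) with hq
  have hone : ∀ n : ℕ, ¬ IsNonposInt ((n : ℂ) + 1) := by
    rintro n ⟨k, hk⟩
    have : (n : ℂ) + 1 + k = 0 := by rw [hk]; ring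
    have h2 : n + 1 + k = 0 := by exact_mod_cast this
    omega
  have hqd : q ∈ hypDomain := by
    refine ⟨?_, ?_, ?_⟩
    · simpa [hq] using hone 0
    · simpa [hq] using hone 0
    · simpa [hq, hypExcess_eq] using hone 1
  have hqs : 0 < (hypExcess q).re := by simp [hq, hypExcess_eq]
  set L : ℂ → HypParams := fun t => q + t • (p - q) with hL
  have hLd : Differentiable ℂ L := by fun_prop
  have hL0 : L 0 = q := by simp [hL]
  have hL1 : L 1 = p := by simp [hL]
  set U : Set ℂ := L ⁻¹' hypDomain with hU
  have hUo : IsOpen U := isOpen_hypDomain.preimage hLd.continuous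
  have hUc : Uᶜ.Countable := by
    have c1 := countable_setOf_isNonposInt_line (v := (p - q).2.2.2.1) hqd.1
    have c2 := countable_setOf_isNonposInt_line (v := (p - q).2.2.2.2) hqd.2.1
    have c3 := countable_setOf_isNonposInt_line (v := hypExcess (p - q)) hqd.2.2
    refine ((c1.union c2).union c3).mono fun t ht => ?_
    have e1 : (L t).2.2.2.1 = q.2.2.2.1 + t * (p - q).2.2.2.1 := rfl
    have e2 : (L t).2.2.2.2 = q.2.2.2.2 + t * (p - q).2.2.2.2 := rfl
    have e3 : hypExcess (L t) = hypExcess q + t * hypExcess (p - q) := by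
      simp only [hypExcess_eq, hL, Prod.fst_add, Prod.snd_add, Prod.smul_fst, Prod.smul_snd,
        smul_eq_mul]
      ring
    by_contra hcon
    simp only [Set.mem_union, Set.mem_ofPred_eq, not_or, ← e1, ← e2, ← e3] at hcon
    exact ht ⟨hcon.1.1, hcon.1.2, hcon.2⟩
  have hUp : IsPreconnected U := by
    have := (hUc.isPathConnected_compl_of_one_lt_rank (by
      rw [Complex.rank_real_complex]; norm_num)).isConnected.isPreconnected
    rwa [compl_compl] at this
  have hA : ∀ {H : HypParams → ℂ}, IsHypContinuation H → AnalyticOnNhd ℂ (fun t => H (L t)) U :=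
    fun hH => (hH.1.comp hLd.differentiableOn fun t ht => ht).analyticOnNhd hUo
  have h0 : (0 : ℂ) ∈ U := by simpa [hU, hL0] using hqd
  have h1 : (1 : ℂ) ∈ U := by simpa [hU, hL1] using hp
  have hev : (fun t => F (L t)) =ᶠ[𝓝 0] fun t => G (L t) := by
    have hs : ∀ᶠ t in 𝓝 (0 : ℂ), 0 < (hypExcess (L t)).re :=
      ((Complex.continuous_re.comp (differentiable_hypExcess.continuous.comp
        hLd.continuous)).continuousAt (x := (0 : ℂ))).eventually_const_lt (by
          simpa only [Function.comp, hL0] using hqs)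
    filter_upwards [hUo.mem_nhds h0, hs] with t ht hst
    exact (hF.2 _ ht hst).unique (hG.2 _ ht hst)
  have := (hA hF).eqOn_of_preconnected_of_eventuallyEq (hA hG) hUp h0 hev h1
  simpa only [hL1] using this

theorem isHypContinuation_hyp3F2 : IsHypContinuation hyp3F2 := by
  have h : ∃ F : HypParams → ℂ, IsHypContinuation F := ⟨_, isHypContinuation_hypCont⟩
  have e : hyp3F2 = h.choose := by
    funext p
    rw [hyp3F2, dif_pos h]
  rw [e]
  exact h.choose_spec

theorem hyp3F2_eq {p : HypParams} (hp : p ∈ hypDomain) :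
    hyp3F2 p = Gamma p.2.2.2.1 * Gamma p.2.2.2.2 * Gamma (hypExcess p) * regHyp p :=
  isHypContinuation_hyp3F2.eqOn isHypContinuation_hypCont hp

/-- Equality of regularized values gives a transformation formula for `hyp3F2`. -/
theorem hyp3F2_eq_mul_of_regHyp_eq {p q : HypParams} (hp : p ∈ hypDomain) (hq : q ∈ hypDomain)
    (h : regHyp p = regHyp q) {N D : ℂ}
    (hN : Gamma p.2.2.2.1 * Gamma p.2.2.2.2 * Gamma (hypExcess p) * D =
      N * (Gamma q.2.2.2.1 * Gamma q.2.2.2.2 * Gamma (hypExcess q))) (hD : D ≠ 0) :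
    hyp3F2 p = hyp3F2 q * N / D := by
  rw [hyp3F2_eq hp, hyp3F2_eq hq, h, eq_div_iff hD]
  linear_combination regHyp q * hN

/-! ### The six transformations as instances of Thomae's. -/

theorem regHyp_thomae_last (a b c d e : ℂ) :
    regHyp (a, b, c, d, e) = regHyp (e - b, e - a, c, d + e - a - b, e) := by
  rw [regHyp_swap_num, ← regHyp_swap_den _ _ _ (d + e - a - b), regHyp_rotate_num c,
    ← regHyp_swap_den, regHyp_rotate_num c, regHyp_thomae c b a e d]
  ring_nf

theorem mainTheorem4 :
    -- the analytic continuation of the series exists, and `hyp3F2` is that continuation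
    IsHypContinuation hyp3F2 ∧
    -- `P` through `X`
    (∀ (a b c : ℂ) (m n : ℤ),
      whippleParams a b c m n ∈ hypDomain →
      dixonParams (2 * a - b - c + m + 1) (1 + a - c + m) (1 - b + m + n) m n ∈ hypDomain →
      whippleP a b c m n =
        dixonX (2 * a - b - c + m + 1) (1 + a - c + m) (1 - b + m + n) m n *
          (Complex.Gamma (a - n) * Complex.Gamma c) /
          (Complex.Gamma (b + c - 1 - m - n) * Complex.Gamma (a - b + m + 1))) ∧
    -- `P` through `W`
    (∀ (a b c : ℂ) (m n : ℤ),
      whippleParams a b c m n ∈ hypDomain →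
      watsonParams (c - b) (2 * a - c + m + 1 - b) (a - n) m n ∈ hypDomain →
      whippleP a b c m n =
        watsonW (c - b) (2 * a - c + m + 1 - b) (a - n) m n *
          (Complex.Gamma (a - n) * Complex.Gamma c * Complex.Gamma (1 + m + 2 * a - c)) /
          (Complex.Gamma b * Complex.Gamma (2 * a - n) * Complex.Gamma (a - b + m + 1))) ∧
    -- `W` through `X`
    (∀ (a b c : ℂ) (m n : ℤ),
      watsonParams a b c m n ∈ hypDomain →
      dixonParams (2 * c + n - a) ((b - a + m + 1) / 2) ((1 + m - a - b) / 2 + c + n) m n ∈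
        hypDomain →
      watsonW a b c m n =
        dixonX (2 * c + n - a) ((b - a + m + 1) / 2) ((1 + m - a - b) / 2 + c + n) m n *
          (Complex.Gamma (c + n + (1 + m - a - b) / 2) * Complex.Gamma (2 * c + n) *
            Complex.Gamma ((a + b + 1 + m) / 2)) /
          (Complex.Gamma a * Complex.Gamma (c + n + (1 + m + b - a) / 2) *
            Complex.Gamma (2 * c + n + (1 + m - a - b) / 2))) ∧
    -- `X` through `W`
    (∀ (a b c : ℂ) (m n : ℤ),
      dixonParams a b c m n ∈ hypDomain →
      watsonParams (1 + m + a - 2 * b) a (1 + m + a - b - c) m n ∈ hypDomain →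
      dixonX a b c m n =
        watsonW (1 + m + a - 2 * b) a (1 + m + a - b - c) m n *
          (Complex.Gamma (a - 2 * b - 2 * c + 2 + 2 * m + n) *
            Complex.Gamma (1 + a - c + m + n)) /
          (Complex.Gamma (1 - c + m + n) *
            Complex.Gamma (2 * a - 2 * b - 2 * c + 2 + 2 * m + n))) ∧
    -- two further transforms of the general Watson element
    (∀ (a b c : ℂ) (m n : ℤ),
      (a, b, c, c / 2 + b / 2 + n / 2 + 1 / 2 + m / 2, -n + 2 * a) ∈ hypDomain →
      watsonParams c (-b + 2 * a - n) (a - n) m n ∈ hypDomain →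
      hyp3F2 (a, b, c, c / 2 + b / 2 + n / 2 + 1 / 2 + m / 2, -n + 2 * a) =
        watsonW c (-b + 2 * a - n) (a - n) m n *
          (Complex.Gamma (-c / 2 - b / 2 + a - n / 2 + 1 / 2 + m / 2) *
            Complex.Gamma (c / 2 + b / 2 + n / 2 + 1 / 2 + m / 2)) /
          (Complex.Gamma (-c / 2 + b / 2 + n / 2 + 1 / 2 + m / 2) *
            Complex.Gamma (c / 2 - b / 2 + a - n / 2 + 1 / 2 + m / 2))) ∧
    (∀ (a b c : ℂ) (m n : ℤ),
      (a, -a + m + 1, b, c, -c + n + 2 * b + 1 + m) ∈ hypDomain →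
      watsonParams (a - c + n + 2 * b) (-c - a + n + 1 + m + 2 * b) b m n ∈ hypDomain →
      hyp3F2 (a, -a + m + 1, b, c, -c + n + 2 * b + 1 + m) =
        watsonW (a - c + n + 2 * b) (-c - a + n + 1 + m + 2 * b) b m n *
          (Complex.Gamma (b + n) * Complex.Gamma c) /
          (Complex.Gamma (c - b) * Complex.Gamma (2 * b + n))) := by
  refine ⟨isHypContinuation_hyp3F2, ?_, ?_, ?_, ?_, ?_, ?_⟩
  · intro a b c m n hp hq
    -- The pattern of all six cases: match the regularized values by a Thomae transformation, match
    -- the gamma products, and note that each factor of the denominator is the gamma of a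
    -- denominator parameter or of the excess on the right-hand side, hence nonzero by `hq`.
    refine hyp3F2_eq_mul_of_regHyp_eq hp hq ?_ ?_ ?_
    · rw [whippleParams, dixonParams, regHyp_thomae_last]
      ring_nf
    · simp only [whippleParams, dixonParams, hypExcess_eq]
      ring_nf
    · have h1 := Gamma_ne_zero_of_not_isNonposInt hq.1
      have h2 := Gamma_ne_zero_of_not_isNonposInt hq.2.2
      simp only [dixonParams, hypExcess_eq] at h1 h2
      ring_nf at h1 h2 ⊢
      exact mul_ne_zero ‹_› ‹_›
  · intro a b c m n hp hq
    refine hyp3F2_eq_mul_of_regHyp_eq hp hq ?_ ?_ ?_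
    -- With `b` brought to the front it becomes the excess of the Watson side, whence `Γ(b)` in the
    -- denominator.
    · rw [whippleParams, watsonParams, ← regHyp_swap_num, regHyp_thomae_full, ← regHyp_swap_den]
      ring_nf
    · simp only [whippleParams, watsonParams, hypExcess_eq]
      ring_nf
    · have h1 := Gamma_ne_zero_of_not_isNonposInt hq.1
      have h2 := Gamma_ne_zero_of_not_isNonposInt hq.2.1
      have h3 := Gamma_ne_zero_of_not_isNonposInt hq.2.2
      simp only [watsonParams, hypExcess_eq] at h1 h2 h3
      ring_nf at h1 h2 h3 ⊢
      exact mul_ne_zero (mul_ne_zero ‹_› ‹_›) ‹_›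
  · intro a b c m n hp hq
    refine hyp3F2_eq_mul_of_regHyp_eq hp hq ?_ ?_ ?_
    · rw [watsonParams, dixonParams, regHyp_thomae_full, ← regHyp_swap_den, ← regHyp_swap_num]
      ring_nf
    · simp only [dixonParams, watsonParams, hypExcess_eq]
      ring_nf
    · have h1 := Gamma_ne_zero_of_not_isNonposInt hq.1
      have h2 := Gamma_ne_zero_of_not_isNonposInt hq.2.1
      have h3 := Gamma_ne_zero_of_not_isNonposInt hq.2.2
      simp only [dixonParams, hypExcess_eq] at h1 h2 h3
      ring_nf at h1 h2 h3 ⊢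
      exact mul_ne_zero (mul_ne_zero ‹_› ‹_›) ‹_›
  · intro a b c m n hp hq
    refine hyp3F2_eq_mul_of_regHyp_eq hp hq ?_ ?_ ?_
    · rw [watsonParams, dixonParams, regHyp_thomae, ← regHyp_swap_num]
      ring_nf
    · simp only [dixonParams, watsonParams, hypExcess_eq]
      ring_nf
    · have h2 := Gamma_ne_zero_of_not_isNonposInt hq.2.1
      have h3 := Gamma_ne_zero_of_not_isNonposInt hq.2.2
      simp only [watsonParams, hypExcess_eq] at h2 h3
      ring_nf at h2 h3 ⊢
      exact mul_ne_zero ‹_› ‹_›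
  · intro a b c m n hp hq
    refine hyp3F2_eq_mul_of_regHyp_eq hp hq ?_ ?_ ?_
    · rw [watsonParams, regHyp_thomae_last, ← regHyp_rotate_num c]
      ring_nf
    · simp only [watsonParams, hypExcess_eq]
      ring_nf
    · have h1 := Gamma_ne_zero_of_not_isNonposInt hq.1
      have h3 := Gamma_ne_zero_of_not_isNonposInt hq.2.2
      simp only [watsonParams, hypExcess_eq] at h1 h3
      ring_nf at h1 h3 ⊢
      exact mul_ne_zero ‹_› ‹_›
  · intro a b c m n hp hq
    refine hyp3F2_eq_mul_of_regHyp_eq hp hq ?_ ?_ ?_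
    · rw [watsonParams, regHyp_thomae_last, ← regHyp_swap_den]
      ring_nf
    · simp only [watsonParams, hypExcess_eq]
      ring_nf
    · have h2 := Gamma_ne_zero_of_not_isNonposInt hq.2.1
      have h3 := Gamma_ne_zero_of_not_isNonposInt hq.2.2
      simp only [watsonParams, hypExcess_eq] at h2 h3
      ring_nf at h2 h3 ⊢
      exact mul_ne_zero ‹_› ‹_›
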